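/- Let $G$ be a connected Lie group with Lie algebra $\mathfrak g$, let $M$ be a smooth (Hausdorff, second countable, finite-dimensional) manifold with a smooth left $G$-action, and let $\omega$ be a symplectic form on $M$. For $\xi\in\mathfrak g$ let $\xi_M(x)=\frac{d}{dt}\big|_{t=0}\exp(t\xi)x$. Suppose $J\colon M\to\mathfrak g^*$ is an equivariant momentum map, i.e. $J$ is smooth, $\omega(\xi_M,\cdot)=d\langle J,\xi\rangle$ for all $\xi\in\mathfrak g$, and $J(gx)=\mathrm{Ad}^*(g)J(x)$, where $\langle \mathrm{Ad}^*(g)\mu,\xi\rangle=\langle\mu,\mathrm{Ad}(g^{-1})\xi\rangle$. Assume that $0$ is a regular value of $J$, that the constraint surface $C:=J^{-1}(0)$ is nonempty, and that $G$ acts freely and properly on $C$. Let $C^\infty(C)$ be the space of smooth complex-valued functions on the submanifold $C$, regarded as a $\mathfrak g$-module by $\rho(\xi)f=-\xi_C f$, where $\xi_C$ is the restriction of $\xi_M$ to $C$. Let $H^1_{CE}(\mathfrak g,C^\infty(C))$ be the first Chevalley–Eilenberg cohomology: the linear maps $\beta\colon\mathfrak g\to C^\infty(C)$ with $\rho(\xi)\beta(\eta)-\rho(\eta)\beta(\xi)-\beta([\xi,\eta])=0$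 for all $\xi,\eta\in\mathfrak g$, modulo the maps $\xi\mapsto\rho(\xi)f$ with $f\in C^\infty(C)$. Then $$H^1_{CE}(\mathfrak g,C^\infty(C))=0\iff H^1_{dR}(G)=0,$$ where $H^1_{dR}(G)$ is the first de Rham cohomology of the manifold $G$ (smooth closed complex-valued one-forms modulo differentials of smooth functions). -/

import Mathlib

open scoped Manifold ContDiff Topology

/-! ### First Lie algebra cohomology -/

section LieCohomology

variable (R L Q : Type*) [CommRing R] [LieRing L] [LieAlgebra R L] [AddCommGroup Q] [Module R Q]
  [LieRingModule L Q] [LieModule R L Q]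

/-- The Chevalley-Eilenberg differential from degree zero to degree one, `q ↦ (ξ ↦ ⁅ξ, q⁆)`. -/
def ceDifferentialZero : Q →ₗ[R] LieModule.Cohomology.oneCochain R L Q :=
  (LieModule.toEnd R L Q : L →ₗ[R] Module.End R Q).flip

theorem ceDifferentialZero_apply (q : Q) (x : L) : ceDifferentialZero R L Q q x = ⁅x, q⁆ := rfl

theorem range_ceDifferentialZero_le : LinearMap.range (ceDifferentialZero R L Q) ≤
    LinearMap.ker (LieModule.Cohomology.d₁₂ R L Q) := by
  rintro _ ⟨q, rfl⟩
  rw [LinearMap.mem_ker]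
  ext x y
  simp [ceDifferentialZero_apply]

/-- The first Chevalley-Eilenberg cohomology of `L` with values in the `L`-module `Q`: one-cocycles,
i.e. linear maps `β : L → Q` with `⁅x, β y⁆ - ⁅y, β x⁆ - β ⁅x, y⁆ = 0`, modulo the coboundaries
`x ↦ ⁅x, q⁆`. -/
abbrev ChevalleyEilenbergH1 : Type _ :=
  LinearMap.ker (LieModule.Cohomology.d₁₂ R L Q) ⧸
    (LinearMap.range (ceDifferentialZero R L Q)).submoduleOf
      (LinearMap.ker (LieModule.Cohomology.d₁₂ R L Q))

end LieCohomology

/-! ### Differential forms and first de Rham cohomology of a manifold -/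

section Forms

open Set

variable (V : Type*) [NormedAddCommGroup V] [NormedSpace ℝ V]
variable (M : Type*) [TopologicalSpace M] [ChartedSpace V M]

/-- (Not necessarily continuous) fields of alternating `k`-forms with values in `F` on the
manifold `M` modelled on `V`. -/
abbrev FormField (k : ℕ) (F : Type*) [NormedAddCommGroup F] [NormedSpace ℝ F] : Type _ :=
  ∀ x : M, TangentSpace 𝓘(ℝ, V) x [⋀^Fin k]→L[ℝ] F

variable {V M} {k : ℕ} {F : Type*} [NormedAddCommGroup F] [NormedSpace ℝ F]

namespace FormField

/-- The coordinate expression of a form in the chart at `x₀`: its pullback under the inverse chart,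
a form on the model space `V`. -/
noncomputable def inChart (α : FormField V M k F) (x₀ : M) (y : V) : V [⋀^Fin k]→L[ℝ] F :=
  (α ((extChartAt 𝓘(ℝ, V) x₀).symm y)).compContinuousLinearMap
    (mfderiv 𝓘(ℝ, V) 𝓘(ℝ, V) (extChartAt 𝓘(ℝ, V) x₀).symm y)

/-- The form is smooth: all its coordinate expressions are. -/
def IsSmooth (α : FormField V M k F) : Prop :=
  ∀ x₀ : M, ContDiffOn ℝ ∞ (inChart α x₀) (extChartAt 𝓘(ℝ, V) x₀).target

/-- The form is closed: the exterior derivatives of all its coordinate expressions vanish. -/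
def IsClosedForm (α : FormField V M k F) : Prop :=
  ∀ x₀ : M, ∀ y ∈ (extChartAt 𝓘(ℝ, V) x₀).target, extDeriv (inChart α x₀) y = 0

theorem inChart_zero (x₀ : M) : inChart (0 : FormField V M k F) x₀ = 0 := by
  ext y v; rfl
theorem inChart_add (α β : FormField V M k F) (x₀ : M) :
    inChart (α + β) x₀ = inChart α x₀ + inChart β x₀ := by
  ext y v; rfl
theorem inChart_smul (c : ℝ) (α : FormField V M k F) (x₀ : M) :
    inChart (c • α) x₀ = c • inChart α x₀ := by
  ext y v; rfl
theorem IsSmooth.differentiableAt {α : FormField V M k F} (h : IsSmooth α) (x₀ : M) {y : V}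
    (hy : y ∈ (extChartAt 𝓘(ℝ, V) x₀).target) : DifferentiableAt ℝ (inChart α x₀) y :=
  ((h x₀).contDiffAt ((isOpen_extChartAt_target x₀).mem_nhds hy)).differentiableAt (by simp)
end FormField

variable (V M)

open FormField in
/-- The space of smooth closed complex-valued one-forms on `M`. -/
def closedOneForms : Submodule ℝ (FormField V M 1 ℂ) where
  carrier := {β | IsSmooth β ∧ IsClosedForm β}
  zero_mem' := by
    refine ⟨fun x₀ ↦ ?_, fun x₀ y _ ↦ ?_⟩
    · rw [inChart_zero]; exact contDiffOn_const
    · rw [inChart_zero]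
      ext v
      simp [extDeriv, ContinuousAlternatingMap.alternatizeUncurryFin_apply]
  add_mem' := by
    rintro α β ⟨ha, ha'⟩ ⟨hb, hb'⟩
    refine ⟨fun x₀ ↦ ?_, fun x₀ y hy ↦ ?_⟩
    · rw [inChart_add]; exact (ha x₀).add (hb x₀)
    · rw [inChart_add, extDeriv_add (ha.differentiableAt x₀ hy) (hb.differentiableAt x₀ hy),
        ha' x₀ y hy, hb' x₀ y hy, add_zero]
  smul_mem' := by
    rintro c α ⟨ha, ha'⟩
    refine ⟨fun x₀ ↦ ?_, fun x₀ y hy ↦ ?_⟩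
    · rw [inChart_smul]; exact (ha x₀).const_smul c
    · rw [inChart_smul, extDeriv_smul, ha' x₀ y hy, smul_zero]

/-- The differential `φ ↦ dφ` from smooth complex-valued functions to one-forms. -/
noncomputable def functionDifferential :
    C^∞⟮𝓘(ℝ, V), M; 𝓘(ℝ, ℂ), ℂ⟯ →ₗ[ℝ] FormField V M 1 ℂ where
  toFun φ x := ContinuousAlternatingMap.ofSubsingleton ℝ (TangentSpace 𝓘(ℝ, V) x) ℂ (0 : Fin 1)
    (mvfderiv 𝓘(ℝ, V) φ x)
  map_add' φ ψ := by
    ext x v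
    exact congrArg (· (v 0)) (mfderiv_add (φ.contMDiff.mdifferentiable (by simp) x)
      (ψ.contMDiff.mdifferentiable (by simp) x))
  map_smul' c φ := by
    ext x v
    exact congrArg (· (v 0)) (const_smul_mfderiv (φ.contMDiff.mdifferentiable (by simp) x) c)

open FormField in
theorem range_functionDifferential_le [IsManifold 𝓘(ℝ, V) ∞ M] :
    LinearMap.range (functionDifferential V M) ≤ closedOneForms V M := by
  rintro _ ⟨φ, rfl⟩
  have hs (x₀ : M) : ContDiffOn ℝ ∞ (φ ∘ (extChartAt 𝓘(ℝ, V) x₀).symm)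
      (extChartAt 𝓘(ℝ, V) x₀).target := by
    rw [← contMDiffOn_iff_contDiffOn]
    exact φ.contMDiff.comp_contMDiffOn (contMDiffOn_extChartAt_symm x₀)
  have key (x₀ : M) : ∀ y ∈ (extChartAt 𝓘(ℝ, V) x₀).target,
      inChart (functionDifferential V M φ) x₀ y =
        ContinuousAlternatingMap.ofSubsingleton ℝ V ℂ (0 : Fin 1)
          (fderiv ℝ (φ ∘ (extChartAt 𝓘(ℝ, V) x₀).symm) y) := by
    intro y hy
    have h1 := mdifferentiableWithinAt_extChartAt_symm (I := 𝓘(ℝ, V)) hy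
    rw [show range 𝓘(ℝ, V) = univ by simp, mdifferentiableWithinAt_univ] at h1
    have h2 := mfderiv_comp y (φ.contMDiff.mdifferentiable (by simp) _) h1
    rw [mfderiv_eq_fderiv] at h2
    ext v
    exact (congrArg (fun L ↦ L (v 0)) h2).symm
  refine ⟨fun x₀ ↦ ?_, fun x₀ y hy ↦ ?_⟩
  · refine ContDiffOn.congr ?_ (key x₀)
    exact (ContinuousAlternatingMap.ofSubsingletonLIE (𝕜 := ℝ) (E := V) (F := ℂ) (0 : Fin 1)).contDiff.comp_contDiffOn
      ((hs x₀).fderiv_of_isOpen (isOpen_extChartAt_target x₀) (by simp))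
  · have hy' := (isOpen_extChartAt_target x₀).mem_nhds hy
    have he : inChart (functionDifferential V M φ) x₀ =ᶠ[𝓝 y] extDeriv
        fun z ↦ ContinuousAlternatingMap.constOfIsEmpty ℝ V (Fin 0)
          ((φ ∘ (extChartAt 𝓘(ℝ, V) x₀).symm) z) := by
      filter_upwards [hy'] with z hz
      rw [key x₀ z hz, extDeriv_constOfIsEmpty]
    rw [he.extDeriv_eq]
    refine extDeriv_extDeriv_apply (r := ∞) ?_ (by simpa using ENat.LEInfty.out)
    exact (ContinuousAlternatingMap.constOfIsEmptyLIE ℝ V ℂ (Fin 0)).contDiff.contDiffAt.comp y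
      ((hs x₀).contDiffAt hy')

/-- The first de Rham cohomology of `M` (complex-valued forms): smooth closed one-forms modulo
differentials of smooth functions. -/
abbrev DeRhamH1 : Type _ :=
  closedOneForms V M ⧸ (LinearMap.range (functionDifferential V M)).submoduleOf (closedOneForms V M)

end Forms

/-! ### Smooth actions and the induced Lie algebra representation on functions -/

section Actions

open Set

/-- A smooth real Lie group is regular enough for Mathlib's Lie bracket on its Lie algebra. -/
instance LieGroup.minSmoothnessThree {W : Type*} [NormedAddCommGroup W] [NormedSpace ℝ W]
    {G : Type*} [TopologicalSpace G] [ChartedSpace W G] [Group G] [LieGroup 𝓘(ℝ, W) ∞ G] :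
    LieGroup 𝓘(ℝ, W) (minSmoothness ℝ 3) G := by
  rw [minSmoothness_of_isRCLikeNormedField]; infer_instance

/-- The Lie bracket of vector fields is the commutator of the corresponding derivations. -/
theorem mfderiv_mlieBracket_apply {W : Type*} [NormedAddCommGroup W] [NormedSpace ℝ W] [CompleteSpace W]
    {G : Type*} [TopologicalSpace G] [ChartedSpace W G] [IsManifold 𝓘(ℝ, W) ∞ G]
    {F : G → ℂ} (hF : ContMDiff 𝓘(ℝ, W) 𝓘(ℝ, ℂ) ∞ F) {X Y : ∀ g : G, TangentSpace 𝓘(ℝ, W) g} (x : G)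
    (hX : MDifferentiableAt 𝓘(ℝ, W) 𝓘(ℝ, W).tangent (fun g ↦ (X g : TangentBundle 𝓘(ℝ, W) G)) x)
    (hY : MDifferentiableAt 𝓘(ℝ, W) 𝓘(ℝ, W).tangent (fun g ↦ (Y g : TangentBundle 𝓘(ℝ, W) G)) x)
    {FX FY : G → ℂ} (hFX : MDifferentiableAt 𝓘(ℝ, W) 𝓘(ℝ, ℂ) FX x) (hFY : MDifferentiableAt 𝓘(ℝ, W) 𝓘(ℝ, ℂ) FY x)
    (eX : ∀ g, mvfderiv 𝓘(ℝ, W) F g (X g) = FX g)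
    (eY : ∀ g, mvfderiv 𝓘(ℝ, W) F g (Y g) = FY g) :
    mvfderiv 𝓘(ℝ, W) F x (VectorField.mlieBracket 𝓘(ℝ, W) X Y x) =
      mvfderiv 𝓘(ℝ, W) FY x (X x) - mvfderiv 𝓘(ℝ, W) FX x (Y x) := by
  have hr : range 𝓘(ℝ, W) = univ := by simp
  let φ := extChartAt 𝓘(ℝ, W) x
  let A : W → W := VectorField.mpullbackWithin 𝓘(ℝ, W) 𝓘(ℝ, W) φ.symm X (range 𝓘(ℝ, W))
  let B : W → W := VectorField.mpullbackWithin 𝓘(ℝ, W) 𝓘(ℝ, W) φ.symm Y (range 𝓘(ℝ, W))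
  have hu : φ.symm ⁻¹' univ ∩ range 𝓘(ℝ, W) = univ := by simp
  have hX' : DifferentiableAt ℝ A (φ x) := by
    have := MDifferentiableWithinAt.differentiableWithinAt_mpullbackWithin_vectorField
      (s := univ) hX.mdifferentiableWithinAt
    exact differentiableWithinAt_univ.1 (hu ▸ this)
  have hY' : DifferentiableAt ℝ B (φ x) := by
    have := MDifferentiableWithinAt.differentiableWithinAt_mpullbackWithin_vectorField
      (s := univ) hY.mdifferentiableWithinAt
    exact differentiableWithinAt_univ.1 (hu ▸ this)
  have hbr : VectorField.mlieBracket 𝓘(ℝ, W) X Y x =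
      (mfderiv 𝓘(ℝ, W) 𝓘(ℝ, W) φ x).inverse (fderiv ℝ B (φ x) (A (φ x)) - fderiv ℝ A (φ x) (B (φ x))) := by
    have h1 : VectorField.lieBracketWithin ℝ A B (φ.symm ⁻¹' univ ∩ range 𝓘(ℝ, W)) (φ x) =
      fderiv ℝ B (φ x) (A (φ x)) - fderiv ℝ A (φ x) (B (φ x)) := by
      rw [hu, VectorField.lieBracketWithin_univ, VectorField.lieBracket_eq]
    exact congrArg _ h1
  have hmem : φ x ∈ φ.target := mem_extChartAt_target x
  have hopen : IsOpen φ.target := isOpen_extChartAt_target x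
  have hinv {y : W} (hy : y ∈ φ.target) :
      (mfderiv 𝓘(ℝ, W) 𝓘(ℝ, W) φ.symm y).IsInvertible := by
    have := isInvertible_mfderivWithin_extChartAt_symm (I := 𝓘(ℝ, W)) hy
    rwa [hr, mfderivWithin_univ] at this
  have hsd {y : W} (hy : y ∈ φ.target) : MDifferentiableAt 𝓘(ℝ, W) 𝓘(ℝ, W) φ.symm y := by
    have := mdifferentiableWithinAt_extChartAt_symm (I := 𝓘(ℝ, W)) hy
    rwa [hr, mdifferentiableWithinAt_univ] at this
  have hcomp {f : G → ℂ} {y : W} (hy : y ∈ φ.target)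
      (hf : MDifferentiableAt 𝓘(ℝ, W) 𝓘(ℝ, ℂ) f (φ.symm y)) (v : W) :
      fderiv ℝ (f ∘ φ.symm) y v =
        mvfderiv 𝓘(ℝ, W) f (φ.symm y) (mfderiv 𝓘(ℝ, W) 𝓘(ℝ, W) φ.symm y v) := by
    rw [← mfderiv_eq_fderiv]
    exact congrArg (fun L ↦ L v) (mfderiv_comp y hf (hsd hy))
  have hFd := hF.mdifferentiable (by simp)
  have pull {y : W} (hy : y ∈ φ.target) (Z : ∀ g : G, TangentSpace 𝓘(ℝ, W) g) :
      mfderiv 𝓘(ℝ, W) 𝓘(ℝ, W) φ.symm y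
        (VectorField.mpullbackWithin 𝓘(ℝ, W) 𝓘(ℝ, W) φ.symm Z (range 𝓘(ℝ, W)) y) = Z (φ.symm y) := by
    rw [VectorField.mpullbackWithin_apply, hr, mfderivWithin_univ]
    exact (hinv hy).self_apply_inverse _
  have hxx : φ.symm (φ x) = x := extChartAt_to_inv x
  have dX : ∀ y ∈ φ.target, fderiv ℝ (F ∘ φ.symm) y (A y) = (FX ∘ φ.symm) y := by
    intro y hy
    refine (hcomp hy (hFd _) (A y)).trans ?_
    exact (congrArg _ (pull hy X)).trans (eX _)
  have dY : ∀ y ∈ φ.target, fderiv ℝ (F ∘ φ.symm) y (B y) = (FY ∘ φ.symm) y := by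
    intro y hy
    refine (hcomp hy (hFd _) (B y)).trans ?_
    exact (congrArg _ (pull hy Y)).trans (eY _)
  have hFs : ContDiffAt ℝ ∞ (F ∘ φ.symm) (φ x) := by
    rw [← contMDiffAt_iff_contDiffAt]
    refine hF.contMDiffAt.comp _ ?_
    exact (contMDiffOn_extChartAt_symm x).contMDiffAt (hopen.mem_nhds hmem)
  have hsymm : IsSymmSndFDerivAt ℝ (F ∘ φ.symm) (φ x) :=
    hFs.isSymmSndFDerivAt (by simpa using ENat.LEInfty.out)
  have hF2 : DifferentiableAt ℝ (fderiv ℝ (F ∘ φ.symm)) (φ x) :=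
    (hFs.fderiv_right (m := 1) (by norm_num; exact ENat.LEInfty.out)).differentiableAt (by simp)
  have l1 : fderiv ℝ (FY ∘ φ.symm) (φ x) (A (φ x)) =
      fderiv ℝ (fderiv ℝ (F ∘ φ.symm)) (φ x) (A (φ x)) (B (φ x)) +
        fderiv ℝ (F ∘ φ.symm) (φ x) (fderiv ℝ B (φ x) (A (φ x))) := by
    have : (FY ∘ φ.symm) =ᶠ[𝓝 (φ x)] fun y ↦ fderiv ℝ (F ∘ φ.symm) y (B y) := by
      filter_upwards [hopen.mem_nhds hmem] with y hy using (dY y hy).symm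
    rw [this.fderiv_eq, fderiv_clm_apply hF2 hY']
    simp [add_comm]
  have l2 : fderiv ℝ (FX ∘ φ.symm) (φ x) (B (φ x)) =
      fderiv ℝ (fderiv ℝ (F ∘ φ.symm)) (φ x) (B (φ x)) (A (φ x)) +
        fderiv ℝ (F ∘ φ.symm) (φ x) (fderiv ℝ A (φ x) (B (φ x))) := by
    have : (FX ∘ φ.symm) =ᶠ[𝓝 (φ x)] fun y ↦ fderiv ℝ (F ∘ φ.symm) y (A y) := by
      filter_upwards [hopen.mem_nhds hmem] with y hy using (dX y hy).symm
    rw [this.fderiv_eq, fderiv_clm_apply hF2 hX']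
    simp [add_comm]
  have r1 : fderiv ℝ (FY ∘ φ.symm) (φ x) (A (φ x)) = mvfderiv 𝓘(ℝ, W) FY x (X x) := by
    refine (hcomp hmem (hxx.symm ▸ hFY) (A (φ x))).trans ?_
    refine (congrArg _ (pull hmem X)).trans ?_
    rw [hxx]
  have r2 : fderiv ℝ (FX ∘ φ.symm) (φ x) (B (φ x)) = mvfderiv 𝓘(ℝ, W) FX x (Y x) := by
    refine (hcomp hmem (hxx.symm ▸ hFX) (B (φ x))).trans ?_
    refine (congrArg _ (pull hmem Y)).trans ?_
    rw [hxx]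
  have r3 (v : W) : mvfderiv 𝓘(ℝ, W) F x ((mfderiv 𝓘(ℝ, W) 𝓘(ℝ, W) φ x).inverse v) =
      fderiv ℝ (F ∘ φ.symm) (φ x) v := by
    have hi : (mfderiv 𝓘(ℝ, W) 𝓘(ℝ, W) φ x).IsInvertible :=
      isInvertible_mfderiv_extChartAt (mem_extChartAt_source x)
    have h0 : mfderiv 𝓘(ℝ, W) 𝓘(ℝ, W) φ x (mfderiv 𝓘(ℝ, W) 𝓘(ℝ, W) φ.symm (φ x) v) = v := by
      have h := mfderiv_extChartAt_comp_mfderivWithin_extChartAt_symm' (I := 𝓘(ℝ, W))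
        (mem_extChartAt_source (I := 𝓘(ℝ, W)) x)
      rw [hr, mfderivWithin_univ] at h
      exact congrArg (fun L ↦ L v) h
    have h1 : (mfderiv 𝓘(ℝ, W) 𝓘(ℝ, W) φ x).inverse v =
        mfderiv 𝓘(ℝ, W) 𝓘(ℝ, W) φ.symm (φ x) v := by
      refine (congrArg (mfderiv 𝓘(ℝ, W) 𝓘(ℝ, W) φ x).inverse h0.symm).trans ?_
      exact hi.inverse_apply_self _
    rw [h1]
    refine Eq.trans ?_ (hcomp hmem (hFd _) v).symm
    rw [hxx]
  rw [hbr, r3, ← r1, ← r2, l1, l2, map_sub, hsymm (A (φ x)) (B (φ x))]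
  ring
variable {V : Type*} [NormedAddCommGroup V] [NormedSpace ℝ V]
variable {M : Type*} [TopologicalSpace M] [ChartedSpace V M] 
variable {W : Type*} [NormedAddCommGroup W] [NormedSpace ℝ W]
    {G : Type*} [TopologicalSpace G] [ChartedSpace W G] [Group G] [MulAction G M]

variable (V) in
/-- The space `C^∞(C)` of smooth complex-valued functions on a `G`-invariant subset `C` of `M`: the
functions on `C` that near each point of `C` are restrictions of smooth functions defined on an open
subset of `M`. If `C` is an embedded submanifold, these are exactly the smooth functions for
its submanifold structure. -/
def smoothFunctions (C : SubMulAction G M) : Submodule ℝ (C → ℂ) where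
  carrier := {f | ∀ c : C, ∃ U : Set M, IsOpen U ∧ (c : M) ∈ U ∧ ∃ F : M → ℂ,
    ContMDiffOn 𝓘(ℝ, V) 𝓘(ℝ, ℂ) ∞ F U ∧ ∀ y : C, (y : M) ∈ U → F y = f y}
  zero_mem' c := ⟨univ, isOpen_univ, mem_univ _, 0, contMDiffOn_const, fun _ _ ↦ rfl⟩
  add_mem' {f₁ f₂} h₁ h₂ c := by
    obtain ⟨U₁, o₁, m₁, F₁, s₁, e₁⟩ := h₁ c
    obtain ⟨U₂, o₂, m₂, F₂, s₂, e₂⟩ := h₂ c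
    refine ⟨U₁ ∩ U₂, o₁.inter o₂, ⟨m₁, m₂⟩, F₁ + F₂,
      (s₁.mono inter_subset_left).add (s₂.mono inter_subset_right), fun y hy ↦ ?_⟩
    simp [e₁ y hy.1, e₂ y hy.2]
  smul_mem' a f h c := by
    obtain ⟨U, o, m, F, s, e⟩ := h c
    refine ⟨U, o, m, a • F, fun z hz ↦ ?_, fun y hy ↦ ?_⟩
    · exact ContMDiffWithinAt.smul (I := 𝓘(ℝ, ℝ)) (I' := 𝓘(ℝ, ℂ)) contMDiffWithinAt_const (s z hz)
    · simp [e y hy]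

namespace smoothFunctions
variable {C : SubMulAction G M}

theorem contMDiff_orbit [ContMDiffSMul 𝓘(ℝ, W) 𝓘(ℝ, V) ∞ G M] (f : smoothFunctions V C) (c : C) :
    ContMDiff 𝓘(ℝ, W) 𝓘(ℝ, ℂ) ∞ (fun g : G ↦ (f : C → ℂ) (g • c)) := by
  intro g
  obtain ⟨U, o, m, F, s, e⟩ := f.2 (g • c)
  have hact : ContMDiff 𝓘(ℝ, W) 𝓘(ℝ, V) ∞ (fun g : G ↦ g • (c : M)) :=
    contMDiff_id.smul (I := 𝓘(ℝ, W)) contMDiff_const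
  have h1 : ContMDiffAt 𝓘(ℝ, W) 𝓘(ℝ, ℂ) ∞ (fun g : G ↦ F (g • (c : M))) g :=
    (s.contMDiffAt (o.mem_nhds m)).comp g (hact g)
  refine h1.congr_of_eventuallyEq ?_
  filter_upwards [(o.preimage hact.continuous).mem_nhds m] with h hh
  exact (e (h • c) hh).symm

theorem derivative_mem [IsManifold 𝓘(ℝ, V) ∞ M] [LieGroup 𝓘(ℝ, W) ∞ G] [ContMDiffSMul 𝓘(ℝ, W) 𝓘(ℝ, V) ∞ G M] (f : smoothFunctions V C) 
    (ξ : GroupLieAlgebra 𝓘(ℝ, W) G) :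
    (fun c : C ↦ -(mvfderiv 𝓘(ℝ, W) (fun g : G ↦ (f : C → ℂ) (g • c)) 1 ξ)) ∈
      smoothFunctions V C := by
  intro c
  obtain ⟨U, o, m, F, s, e⟩ := f.2 c
  refine ⟨U, o, m, fun y ↦ -(mvfderiv 𝓘(ℝ, W) (fun g : G ↦ F (g • y)) 1 ξ), ?_, ?_⟩
  · intro y hy
    have hact : ContMDiff (𝓘(ℝ, V).prod 𝓘(ℝ, W)) 𝓘(ℝ, V) ∞ (fun p : M × G ↦ p.2 • p.1) :=
      contMDiff_snd.smul (I := 𝓘(ℝ, W)) contMDiff_fst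
    have hF : ContMDiffAt (𝓘(ℝ, V).prod 𝓘(ℝ, W)) 𝓘(ℝ, ℂ) ∞
        (Function.uncurry fun (y : M) (g : G) ↦ F (g • y)) (y, 1) :=
      ContMDiffAt.comp (g := F) (f := fun p : M × G ↦ p.2 • p.1) (y, (1 : G))
        (s.contMDiffAt (o.mem_nhds (by simpa using hy))) (hact _)
    have := ContMDiffAt.mfderiv_apply (m := ∞) (E := W) (fun (y : M) (g : G) ↦ F (g • y)) (fun _ : M ↦ (1 : G))
      (id : M → M) (fun _ ↦ (ξ : W)) hF contMDiffAt_const contMDiffAt_id contMDiffAt_const (by simp)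
    refine ContMDiffAt.contMDiffWithinAt (ContMDiffAt.neg ?_)
    refine this.congr_of_eventuallyEq (Filter.Eventually.of_forall fun z ↦ ?_)
    dsimp only [id]
    have h1 := inTangentCoordinates_eq (I := 𝓘(ℝ, W)) (I' := 𝓘(ℝ, ℂ)) (fun _ : M ↦ (1 : G))
      (fun y : M ↦ F ((1 : G) • y)) (fun x ↦ mfderiv 𝓘(ℝ, W) 𝓘(ℝ, ℂ) (fun g : G ↦ F (g • x)) 1) 
      (x₀ := y) (x := z) (mem_chart_source W (1 : G)) (by rw [chartAt_self_eq]; exact mem_univ _)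
    have h2 := (tangentBundleCore 𝓘(ℝ, W) G).coordChange_self (achart W (1 : G)) 1
      (mem_chart_source W (1 : G)) ξ
    refine Eq.trans ?_ (congrArg (fun L ↦ L ξ) h1).symm
    simp only [tangentBundleCore_coordChange_model_space]
    exact (congrArg (mvfderiv 𝓘(ℝ, W) (fun g : G ↦ F (g • z)) 1) h2).symm
  · intro y hy
    have hact : ContMDiff 𝓘(ℝ, W) 𝓘(ℝ, V) ∞ (fun g : G ↦ g • (y : M)) :=
      contMDiff_id.smul (I := 𝓘(ℝ, W)) contMDiff_const
    have : (fun g : G ↦ F (g • (y : M))) =ᶠ[𝓝 1] fun g : G ↦ (f : C → ℂ) (g • y) := by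
      filter_upwards [(o.preimage hact.continuous).mem_nhds (by simpa using hy : (1 : G) ∈ _)] with h hh
      exact e (h • y) hh
    dsimp only
    rw [mvfderiv, this.mfderiv_eq]
    rfl


theorem mvfderiv_comp_inv [LieGroup 𝓘(ℝ, W) ∞ G] {P : G → ℂ}
    (hP : ContMDiff 𝓘(ℝ, W) 𝓘(ℝ, ℂ) ∞ P) (ξ : GroupLieAlgebra 𝓘(ℝ, W) G) :
    mvfderiv 𝓘(ℝ, W) (fun k : G ↦ P k⁻¹) 1 ξ = -mvfderiv 𝓘(ℝ, W) P 1 ξ := by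
  have hQ : ContMDiff (𝓘(ℝ, W).prod 𝓘(ℝ, W)) 𝓘(ℝ, ℂ) ∞ (fun p : G × G ↦ P (p.1 * p.2⁻¹)) :=
    hP.comp (contMDiff_fst.mul (contMDiff_snd.inv))
  have h1 := mfderiv_prod_eq_add_apply (v := ((ξ, ξ) : W × W))
    (hQ.mdifferentiable (by simp) ((1 : G), (1 : G)))
  have hd : ContMDiff 𝓘(ℝ, W) (𝓘(ℝ, W).prod 𝓘(ℝ, W)) ∞ (fun k : G ↦ (k, k)) :=
    contMDiff_id.prodMk contMDiff_id
  have h2 := mfderiv_comp_apply (f := fun k : G ↦ (k, k)) (1 : G) (hQ.mdifferentiable (by simp) ((1 : G), (1 : G)))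
    (hd.mdifferentiable (by simp) (1 : G)) ξ
  have h3 : (fun p : G × G ↦ P (p.1 * p.2⁻¹)) ∘ (fun k : G ↦ (k, k)) = fun _ ↦ P 1 := by
    ext k; simp
  have h4 : mfderiv 𝓘(ℝ, W) (𝓘(ℝ, W).prod 𝓘(ℝ, W)) (fun k : G ↦ (k, k)) 1 ξ = ((ξ, ξ) : W × W) := by
    have := mfderiv_prodMk (x := (1 : G)) (mdifferentiableAt_id (I := 𝓘(ℝ, W))) (mdifferentiableAt_id (I := 𝓘(ℝ, W)))
    rw [mfderiv_id] at this
    exact congrArg (fun L ↦ L ξ) this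
  rw [h3, mfderiv_const] at h2
  have h5 := h2.symm.trans (Eq.refl _)
  have h6 := (congrArg (mfderiv (𝓘(ℝ, W).prod 𝓘(ℝ, W)) 𝓘(ℝ, ℂ) (fun p : G × G ↦ P (p.1 * p.2⁻¹)) (1, 1)) h4).symm.trans h5
  have h7 := h1.symm.trans h6
  have h8 : mvfderiv 𝓘(ℝ, W) (fun z : G ↦ P (z * 1⁻¹)) 1 ξ +
      mvfderiv 𝓘(ℝ, W) (fun z : G ↦ P (1 * z⁻¹)) 1 ξ = 0 := h7
  simp only [inv_one, mul_one, one_mul] at h8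
  exact eq_neg_of_add_eq_zero_right h8

/-- The action of the Lie algebra on `C^∞(C)`, given by
`(⁅ξ, f⁆) (c) = - (ξ_C f) (c) = - d/dt f (exp (t ξ) • c)` at `t = 0`, that is, minus the derivative
at `g = 1` in the direction `ξ` of `g ↦ f (g • c)`. -/
noncomputable instance instBracket [IsManifold 𝓘(ℝ, V) ∞ M] [LieGroup 𝓘(ℝ, W) ∞ G]
    [ContMDiffSMul 𝓘(ℝ, W) 𝓘(ℝ, V) ∞ G M] :
    Bracket (GroupLieAlgebra 𝓘(ℝ, W) G) (smoothFunctions V C) where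
  bracket ξ f := ⟨fun c ↦ -(mvfderiv 𝓘(ℝ, W) (fun g : G ↦ (f : C → ℂ) (g • c)) 1 ξ),
    derivative_mem f ξ⟩

theorem contMDiff_orbit_inv [LieGroup 𝓘(ℝ, W) ∞ G] [ContMDiffSMul 𝓘(ℝ, W) 𝓘(ℝ, V) ∞ G M] (f : smoothFunctions V C) (c : C) :
    ContMDiff 𝓘(ℝ, W) 𝓘(ℝ, ℂ) ∞ (fun g : G ↦ (f : C → ℂ) (g⁻¹ • c)) :=
  (contMDiff_orbit f c).comp (contMDiff_inv 𝓘(ℝ, W) ∞)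

variable [IsManifold 𝓘(ℝ, V) ∞ M] [LieGroup 𝓘(ℝ, W) ∞ G]
  [ContMDiffSMul 𝓘(ℝ, W) 𝓘(ℝ, V) ∞ G M]

theorem bracket_apply (ξ : GroupLieAlgebra 𝓘(ℝ, W) G) (f : smoothFunctions V C) (c : C) :
    (⁅ξ, f⁆ : smoothFunctions V C).1 c =
      -(mvfderiv 𝓘(ℝ, W) (fun g : G ↦ (f : C → ℂ) (g • c)) 1 ξ) := rfl

theorem bracket_apply_inv_smul (ξ : GroupLieAlgebra 𝓘(ℝ, W) G) (f : smoothFunctions V C) (c : C)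
    (g : G) : mvfderiv 𝓘(ℝ, W) (fun k : G ↦ (f : C → ℂ) (k⁻¹ • c)) g (mulInvariantVectorField ξ g) =
      (⁅ξ, f⁆ : smoothFunctions V C).1 (g⁻¹ • c) := by
  have hL : ContMDiff 𝓘(ℝ, W) 𝓘(ℝ, W) ∞ (fun k : G ↦ g * k) := contMDiff_mul_left
  have h1 := mfderiv_comp_apply_of_eq (x := (1 : G)) (f := fun k : G ↦ g * k) (y := g)
    ((contMDiff_orbit_inv f c).mdifferentiable (by simp) g) (hL.mdifferentiable (by simp) (1 : G))
    (mul_one g) ξ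
  have h2 : (fun k : G ↦ (f : C → ℂ) (k⁻¹ • c)) ∘ (fun k : G ↦ g * k) =
      fun k : G ↦ (f : C → ℂ) (k⁻¹ • (g⁻¹ • c)) := by
    ext k; simp [mul_smul]
  rw [h2] at h1
  exact h1.symm.trans (mvfderiv_comp_inv (contMDiff_orbit f (g⁻¹ • c)) ξ)

noncomputable instance instLieRingModule [CompleteSpace W] :
    LieRingModule (GroupLieAlgebra 𝓘(ℝ, W) G) (smoothFunctions V C) where
  add_lie ξ η f := by
    ext c
    simp only [bracket_apply, map_add, Submodule.coe_add, Pi.add_apply, neg_add]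
  lie_add ξ f h := by
    ext c
    have := mvfderiv_add (x := (1 : G)) ((contMDiff_orbit (W := W) f c).mdifferentiable (by simp) 1)
      ((contMDiff_orbit (W := W) h c).mdifferentiable (by simp) 1)
    have := congrArg (fun L ↦ -(L ξ)) this
    refine this.trans ?_
    exact neg_add (mvfderiv 𝓘(ℝ, W) (fun g : G ↦ f.1 (g • c)) 1 ξ)
      (mvfderiv 𝓘(ℝ, W) (fun g : G ↦ h.1 (g • c)) 1 ξ)
  leibniz_lie ξ η f := by
    ext c
    have h := mfderiv_mlieBracket_apply (contMDiff_orbit_inv f c) (1 : G)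
      (mdifferentiableAt_mulInvariantVectorField ξ) (mdifferentiableAt_mulInvariantVectorField η)
      ((contMDiff_orbit_inv ⁅ξ, f⁆ c).mdifferentiable (by simp) 1)
      ((contMDiff_orbit_inv ⁅η, f⁆ c).mdifferentiable (by simp) 1)
      (bracket_apply_inv_smul ξ f c) (bracket_apply_inv_smul η f c)
    rw [bracket_apply_inv_smul, bracket_apply_inv_smul, ← GroupLieAlgebra.bracket_def,
      mvfderiv_comp_inv (contMDiff_orbit f c)] at h
    have h' : (⁅⁅ξ, η⁆, f⁆ : smoothFunctions V C).1 c =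
      (⁅ξ, ⁅η, f⁆⁆ : smoothFunctions V C).1 c - (⁅η, ⁅ξ, f⁆⁆ : smoothFunctions V C).1 c := by
      refine h.trans ?_
      rw [inv_one, one_smul]
    simp only [Submodule.coe_add, Pi.add_apply, h', sub_add_cancel]

instance instLieModule [CompleteSpace W] :
    LieModule ℝ (GroupLieAlgebra 𝓘(ℝ, W) G) (smoothFunctions V C) where
  smul_lie t ξ f := by
    ext c
    simp only [bracket_apply, map_smul, Submodule.coe_smul, Pi.smul_apply, smul_neg]
  lie_smul t ξ f := by
    ext c
    have := const_smul_mfderiv (((contMDiff_orbit (W := W) f c).mdifferentiable (by simp) (1 : G))) t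
    have := congrArg (fun L ↦ -(L ξ)) this
    refine this.trans ?_
    exact (smul_neg t (mvfderiv 𝓘(ℝ, W) (fun g : G ↦ f.1 (g • c)) 1 ξ)).symm

end smoothFunctions
variable (W) in
/-- The adjoint action of `g` on the Lie algebra: the derivative at `1` of `h ↦ g * h * g⁻¹`. -/
noncomputable def lieGroupAd (g : G) :
    GroupLieAlgebra 𝓘(ℝ, W) G →L[ℝ] GroupLieAlgebra 𝓘(ℝ, W) G :=
  mfderiv 𝓘(ℝ, W) 𝓘(ℝ, W) (fun h : G ↦ g * h * g⁻¹) 1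

variable (V) in
/-- The infinitesimal generator `ξ_M` of the action: `ξ_M (x)` is the derivative of
`exp (t ξ) • x` at `t = 0`, i.e. the derivative at `1` of the orbit map `g ↦ g • x` applied to `ξ`
(using `1 • x = x`). -/
noncomputable def infinitesimalGenerator (ξ : GroupLieAlgebra 𝓘(ℝ, W) G) (x : M) :
    TangentSpace 𝓘(ℝ, V) x :=
  mfderiv 𝓘(ℝ, W) 𝓘(ℝ, V) (fun g : G ↦ g • x) 1 ξ

end Actions

/-! ### Hamiltonian `G`-spaces -/

/-- The data `(ω, J)` making the `G`-manifold `M` a symplectic Hamiltonian `G`-space. The Lie algebra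
of `G` is `T_1 G`, whose underlying vector space is the model space `W` of `G`, so `J` takes values
in the dual of `W`. -/
structure HamiltonianGSpace
    (V : Type*) [NormedAddCommGroup V] [NormedSpace ℝ V]
    (W : Type*) [NormedAddCommGroup W] [NormedSpace ℝ W]
    (G : Type*) [TopologicalSpace G] [ChartedSpace W G] [Group G]
    (M : Type*) [TopologicalSpace M] [ChartedSpace V M] [MulAction G M] where
  /-- the symplectic form `ω` -/
  form : FormField V M 2 ℝ
  form_smooth : FormField.IsSmooth form
  form_closed : FormField.IsClosedForm form
  form_nondegenerate : ∀ (x : M) (v : TangentSpace 𝓘(ℝ, V) x),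
    (∀ w : TangentSpace 𝓘(ℝ, V) x, form x ![v, w] = 0) → v = 0
  /-- the momentum map `J` -/
  momentum : M → StrongDual ℝ W
  momentum_smooth : ContMDiff 𝓘(ℝ, V) 𝓘(ℝ, StrongDual ℝ W) ∞ momentum
  /-- `ξ_M` is the Hamiltonian vector field of `⟨J, ξ⟩`, i.e. `i_{ξ_M} ω = d⟨J, ξ⟩`. -/
  hamiltonian : ∀ (ξ : GroupLieAlgebra 𝓘(ℝ, W) G) (x : M) (v : TangentSpace 𝓘(ℝ, V) x),
    form x ![infinitesimalGenerator V ξ x, v] = mvfderiv 𝓘(ℝ, V) (fun y ↦ momentum y ξ) x v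
  /-- `J (g • x) = Ad^*(g) (J x)` -/
  equivariant : ∀ (g : G) (x : M) (ξ : GroupLieAlgebra 𝓘(ℝ, W) G),
    momentum (g • x) ξ = momentum x (lieGroupAd W g⁻¹ ξ)

namespace HamiltonianGSpace

variable {V : Type*} [NormedAddCommGroup V] [NormedSpace ℝ V]
  {W : Type*} [NormedAddCommGroup W] [NormedSpace ℝ W]
  {G : Type*} [TopologicalSpace G] [ChartedSpace W G] [Group G]
  {M : Type*} [TopologicalSpace M] [ChartedSpace V M] [MulAction G M]

/-- The constraint surface `C = J⁻¹(0)`, a `G`-invariant subset of `M`. -/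
def constraintSurface (S : HamiltonianGSpace V W G M) : SubMulAction G M where
  carrier := {x | S.momentum x = 0}
  smul_mem' g x hx := by
    ext ξ
    refine (S.equivariant g x ξ).trans ?_
    rw [show S.momentum x = 0 from hx]
    rfl

/-- The constraint surface is regular: it is nonempty and `0` is a regular value of `J`. -/
def HasRegularConstraintSurface (S : HamiltonianGSpace V W G M) : Prop :=
  (∃ x, x ∈ S.constraintSurface) ∧ ∀ x ∈ S.constraintSurface,
    Function.Surjective (mfderiv 𝓘(ℝ, V) 𝓘(ℝ, StrongDual ℝ W) S.momentum x)

end HamiltonianGSpace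

/-! ### Left-invariant vector fields in charts of the group -/

section LeftInvariant

open Set VectorField

variable {W : Type*} [NormedAddCommGroup W] [NormedSpace ℝ W]
  {G : Type*} [TopologicalSpace G] [ChartedSpace W G] [Group G]

/-! Write θ for a one-form on `G` and a(ξ) for its value on the left-invariant field of ξ. Since
these fields form a global frame, closed one-forms are the cocycles a : 𝔤 → C^∞(G) for
left-invariant differentiation, and exact forms are those with a(ξ) = ξφ
(`subsingleton_deRhamH1_iff`). For a point c of `C` the map g ↦ g⁻¹c turns the representation ρ into
left-invariant differentiation (`leftInvDeriv_orbit`), so a cocycle β on `C` restricts to a closed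
one-form on `G` for each c. Both implications compare the two complexes by averaging along orbits
with Haar measure dk and a weight b(k⁻¹c), where b is a smooth cutoff on `C` whose weights have
compact support in k because the action is proper.

If every closed one-form on `G` is exact, let h_c be the primitive with h_c(1) = 0 of the form
obtained from β at c. Connectedness gives h_c(gk) = h_c(g) + h_{g⁻¹c}(k). Put A(c) = ∫ b(k⁻¹c)
h_c(k) dk and χ(c) = ∫ b(k⁻¹c) dk, with b not identically zero on any orbit. Left invariance of dk
gives A(g⁻¹c) = A(c) - h_c(g)χ(c) and χ(g⁻¹c) = χ(c), so f = -A/χ satisfies f(g⁻¹c) = f(c) + h_c(g),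
and differentiating at g = 1 gives ρ(ξ)f = β(ξ). This is
`HamiltonianGSpace.exists_ceDifferentialZero_eq`; smoothness of A rests on `contMDiffOn_primitive`
and `HamiltonianGSpace.orbitAverage_mem`.

Conversely, a closed a on `G` is spread over `C` by β(ξ)(c) = ∫ b(k⁻¹c) a(ξ)(k⁻¹) dk, again a
cocycle. If β is the coboundary of f, then g ↦ f(g⁻¹c₀) is a primitive of a weighted average of left
translates of a. As the stabilizer of c₀ is trivial and the action is proper, b can be chosen with
its weight at c₀ concentrated near 1; after normalization the average is uniformly close to a on a
given compact set. Limits of exact forms, uniform on compact sets, are exact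
(`exists_primitive_of_approx`), so a is exact. This is `HamiltonianGSpace.exists_primitive`.

Regularity of 0 makes `C` locally a smooth retract of `M`, so smoothness on `C` can be tested along
smooth maps into `C` (`HamiltonianGSpace.mem_smoothFunctions`). -/

/-- The derivative of a function on a Lie group along the left-invariant vector field `ξ`. -/
noncomputable def leftInvDeriv (ξ : GroupLieAlgebra 𝓘(ℝ, W) G) (φ : G → ℂ) (g : G) : ℂ :=
  mvfderiv 𝓘(ℝ, W) φ g (mulInvariantVectorField ξ g)

/-- The left-invariant frame of a Lie group in the chart at `x₀`. -/
noncomputable def chartFrame (x₀ : G) (y : W) : W →L[ℝ] W :=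
  fderiv ℝ (fun z ↦ extChartAt 𝓘(ℝ, W) x₀ ((extChartAt 𝓘(ℝ, W) x₀).symm y *
    (extChartAt 𝓘(ℝ, W) (1 : G)).symm z)) (extChartAt 𝓘(ℝ, W) (1 : G) 1)

variable [LieGroup 𝓘(ℝ, W) ∞ G]

theorem mdifferentiableAt_extChartAt_symm' {M : Type*} [TopologicalSpace M] [ChartedSpace W M]
    [IsManifold 𝓘(ℝ, W) ∞ M] {x₀ : M} {y : W}
    (hy : y ∈ (extChartAt 𝓘(ℝ, W) x₀).target) :
    MDifferentiableAt 𝓘(ℝ, W) 𝓘(ℝ, W) (extChartAt 𝓘(ℝ, W) x₀).symm y :=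
  (((contMDiffOn_extChartAt_symm (n := ∞) x₀).contMDiffAt
    ((isOpen_extChartAt_target x₀).mem_nhds hy))).mdifferentiableAt (by simp)

theorem isInvertible_mfderiv_extChartAt_symm' {M : Type*} [TopologicalSpace M] [ChartedSpace W M]
    [IsManifold 𝓘(ℝ, W) ∞ M] {x₀ : M} {y : W} (hy : y ∈ (extChartAt 𝓘(ℝ, W) x₀).target) :
    (mfderiv 𝓘(ℝ, W) 𝓘(ℝ, W) (extChartAt 𝓘(ℝ, W) x₀).symm y).IsInvertible := by
  have : IsManifold 𝓘(ℝ, W) 1 M := IsManifold.of_le (n := ∞) (by simp)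
  have := isInvertible_mfderivWithin_extChartAt_symm (I := 𝓘(ℝ, W)) hy
  rwa [show range 𝓘(ℝ, W) = univ by simp, mfderivWithin_univ] at this

theorem isInvertible_mfderiv_mul_left (p : G) :
    (mfderiv 𝓘(ℝ, W) 𝓘(ℝ, W) (fun k : G ↦ p * k) 1).IsInvertible := by
  have hL (q : G) : MDifferentiable 𝓘(ℝ, W) 𝓘(ℝ, W) (fun k : G ↦ q * k) :=
    (contMDiff_mul_left (n := ∞) (I := 𝓘(ℝ, W))).mdifferentiable (by simp)
  have h1 := mfderiv_comp_of_eq (x := (1 : G)) (g := fun k : G ↦ p⁻¹ * k) (f := fun k : G ↦ p * k)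
    (y := p) (hL p⁻¹ p) (hL p 1) (mul_one p)
  have h2 := mfderiv_comp_of_eq (x := p) (g := fun k : G ↦ p * k) (f := fun k : G ↦ p⁻¹ * k)
    (y := 1) (hL p 1) (hL p⁻¹ p) (by simp)
  have e1 : (fun k : G ↦ p⁻¹ * k) ∘ (fun k : G ↦ p * k) = id := by ext; simp
  have e2 : (fun k : G ↦ p * k) ∘ (fun k : G ↦ p⁻¹ * k) = id := by ext; simp
  rw [e1, mfderiv_id] at h1
  rw [e2, mfderiv_id] at h2
  rw [inv_mul_cancel] at h2
  rw [mul_one] at h1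
  exact ContinuousLinearMap.IsInvertible.of_inverse (M := W) (M₂ := W) h2.symm h1.symm

/-- The frame is the partial derivative, at the identity, of multiplication read in charts. That
expression is jointly smooth in both factors, hence so is its partial derivative. -/
theorem contDiffOn_chartFrame (x₀ : G) :
    ContDiffOn ℝ ∞ (chartFrame (W := W) x₀) (extChartAt 𝓘(ℝ, W) x₀).target := by
  intro y hy
  have ho := (isOpen_extChartAt_target (I := 𝓘(ℝ, W)) x₀).mem_nhds hy
  have h1 : ContMDiffAt 𝓘(ℝ, W × W) 𝓘(ℝ, W) ∞ (fun q : W × W ↦ (extChartAt 𝓘(ℝ, W) x₀).symm q.1)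
      (y, extChartAt 𝓘(ℝ, W) (1 : G) 1) :=
    ContMDiffAt.comp (g := (extChartAt 𝓘(ℝ, W) x₀).symm) (f := Prod.fst) (I' := 𝓘(ℝ, W)) _
      ((contMDiffOn_extChartAt_symm x₀).contMDiffAt ho) contDiffAt_fst.contMDiffAt
  have h2 : ContMDiffAt 𝓘(ℝ, W × W) 𝓘(ℝ, W) ∞
      (fun q : W × W ↦ (extChartAt 𝓘(ℝ, W) (1 : G)).symm q.2) (y, extChartAt 𝓘(ℝ, W) (1 : G) 1) :=
    ContMDiffAt.comp (g := (extChartAt 𝓘(ℝ, W) (1 : G)).symm) (f := Prod.snd) (I' := 𝓘(ℝ, W)) _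
      ((contMDiffOn_extChartAt_symm (1 : G)).contMDiffAt
        ((isOpen_extChartAt_target (I := 𝓘(ℝ, W)) (1 : G)).mem_nhds (mem_extChartAt_target _)))
      contDiffAt_snd.contMDiffAt
  have h3 : ContMDiffAt 𝓘(ℝ, W × W) 𝓘(ℝ, W) ∞ (fun q : W × W ↦ extChartAt 𝓘(ℝ, W) x₀
      ((extChartAt 𝓘(ℝ, W) x₀).symm q.1 * (extChartAt 𝓘(ℝ, W) (1 : G)).symm q.2))
      (y, extChartAt 𝓘(ℝ, W) (1 : G) 1) := by
    refine ContMDiffAt.comp (g := extChartAt 𝓘(ℝ, W) x₀) (I' := 𝓘(ℝ, W)) _ ?_ (h1.mul h2)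
    refine contMDiffAt_extChartAt' ?_
    have := (extChartAt 𝓘(ℝ, W) x₀).map_target hy
    simpa [extChartAt_to_inv] using this
  refine (ContDiffAt.fderiv (n := ∞) (m := ∞) ?_ contDiffAt_const (by simp)).contDiffWithinAt
  exact h3.contDiffAt

theorem mfderiv_symm_chartFrame (x₀ : G) {y : W} (hy : y ∈ (extChartAt 𝓘(ℝ, W) x₀).target)
    (ξ : GroupLieAlgebra 𝓘(ℝ, W) G) :
    mfderiv 𝓘(ℝ, W) 𝓘(ℝ, W) (extChartAt 𝓘(ℝ, W) x₀).symm y (chartFrame x₀ y ξ) =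
      mulInvariantVectorField ξ ((extChartAt 𝓘(ℝ, W) x₀).symm y) := by
  set p := (extChartAt 𝓘(ℝ, W) x₀).symm y with hp
  have hps : p ∈ (extChartAt 𝓘(ℝ, W) x₀).source := (extChartAt 𝓘(ℝ, W) x₀).map_target hy
  have hyp : extChartAt 𝓘(ℝ, W) x₀ p = y := (extChartAt 𝓘(ℝ, W) x₀).right_inv hy
  have hφ : MDifferentiableAt 𝓘(ℝ, W) 𝓘(ℝ, W) (extChartAt 𝓘(ℝ, W) x₀) p :=
    (contMDiffAt_extChartAt' (n := ∞) (by simpa using hps)).mdifferentiableAt (by simp)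
  have hL : MDifferentiable 𝓘(ℝ, W) 𝓘(ℝ, W) (fun k : G ↦ p * k) :=
    (contMDiff_mul_left (n := ∞) (I := 𝓘(ℝ, W))).mdifferentiable (by simp)
  have hφL : MDifferentiableAt 𝓘(ℝ, W) 𝓘(ℝ, W) (fun k : G ↦ extChartAt 𝓘(ℝ, W) x₀ (p * k)) 1 :=
    MDifferentiableAt.comp (g := extChartAt 𝓘(ℝ, W) x₀) (1 : G) (by simpa using hφ) (hL 1)
  have h1 := mfderiv_comp_apply_of_eq (x := (1 : G)) (f := fun k : G ↦ p * k) (y := p)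
    hφ (hL 1) (mul_one p) ξ
  -- `mfderiv` unfolds to the derivative in the chart at `1`, which is the formula defining
  -- `chartFrame`.
  have h2 : mfderiv 𝓘(ℝ, W) 𝓘(ℝ, W) ((extChartAt 𝓘(ℝ, W) x₀) ∘ fun k : G ↦ p * k) 1 =
      chartFrame x₀ y := by
    refine (if_pos hφL).trans ?_
    simp only [chartFrame, writtenInExtChartAt, modelWithCornersSelf_coe, range_id,
      fderivWithin_univ]
    rfl
  have h3 : mfderiv 𝓘(ℝ, W) 𝓘(ℝ, W) (extChartAt 𝓘(ℝ, W) x₀).symm y ∘L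
      mfderiv 𝓘(ℝ, W) 𝓘(ℝ, W) (extChartAt 𝓘(ℝ, W) x₀) p = ContinuousLinearMap.id ℝ W := by
    have h := mfderiv_comp_of_eq (g := (extChartAt 𝓘(ℝ, W) x₀).symm)
      (mdifferentiableAt_extChartAt_symm' hy) hφ hyp
    have he : (extChartAt 𝓘(ℝ, W) x₀).symm ∘ extChartAt 𝓘(ℝ, W) x₀ =ᶠ[𝓝 p] id := by
      filter_upwards [(isOpen_extChartAt_source (I := 𝓘(ℝ, W)) x₀).mem_nhds hps] with q hq
      exact (extChartAt 𝓘(ℝ, W) x₀).left_inv hq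
    rw [he.mfderiv_eq, mfderiv_id] at h
    rw [hyp] at h
    exact h.symm
  have h4 := (congrArg (fun L ↦ L ξ) h2).symm.trans h1
  refine (congrArg _ h4).trans ?_
  exact congrArg (fun L ↦ L (mulInvariantVectorField ξ p)) h3

theorem isInvertible_chartFrame (x₀ : G) {y : W} (hy : y ∈ (extChartAt 𝓘(ℝ, W) x₀).target) :
    (chartFrame (W := W) x₀ y).IsInvertible := by
  obtain ⟨e, he⟩ := isInvertible_mfderiv_extChartAt_symm' (W := W) hy
  obtain ⟨l, hl⟩ := isInvertible_mfderiv_mul_left (W := W) ((extChartAt 𝓘(ℝ, W) x₀).symm y)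
  refine ⟨(show W ≃L[ℝ] W from l).trans (show W ≃L[ℝ] W from e).symm, ?_⟩
  ext ξ
  have h := mfderiv_symm_chartFrame x₀ hy ξ
  rw [← he] at h
  have h' : (show W ≃L[ℝ] W from l) ξ = mulInvariantVectorField (I := 𝓘(ℝ, W)) (ξ : GroupLieAlgebra 𝓘(ℝ, W) G) ((extChartAt 𝓘(ℝ, W) x₀).symm y) :=
    congrArg (fun L ↦ L ξ) hl
  change (show W ≃L[ℝ] W from e).symm ((show W ≃L[ℝ] W from l) ξ) = _
  rw [ContinuousLinearEquiv.symm_apply_eq]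
  exact h'.trans h.symm

theorem exists_mulInvariantVectorField_eq (g : G) (v : TangentSpace 𝓘(ℝ, W) g) :
    ∃ ξ : GroupLieAlgebra 𝓘(ℝ, W) G, mulInvariantVectorField ξ g = v := by
  obtain ⟨l, hl⟩ := isInvertible_mfderiv_mul_left (W := W) g
  refine ⟨(show W ≃L[ℝ] W from l).symm v, ?_⟩
  exact (congrArg (fun L ↦ L ((show W ≃L[ℝ] W from l).symm v)) hl).symm.trans
    ((show W ≃L[ℝ] W from l).apply_symm_apply v)

theorem fderiv_comp_symm_chartFrame (x₀ : G) {y : W} (hy : y ∈ (extChartAt 𝓘(ℝ, W) x₀).target)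
    {φ : G → ℂ} (hφ : ContMDiff 𝓘(ℝ, W) 𝓘(ℝ, ℂ) ∞ φ) (ξ : GroupLieAlgebra 𝓘(ℝ, W) G) :
    fderiv ℝ (φ ∘ (extChartAt 𝓘(ℝ, W) x₀).symm) y (chartFrame x₀ y ξ) =
      leftInvDeriv ξ φ ((extChartAt 𝓘(ℝ, W) x₀).symm y) := by
  rw [← mfderiv_eq_fderiv]
  refine (congrArg (fun L ↦ L (chartFrame x₀ y ξ)) (mfderiv_comp y
    (hφ.mdifferentiable (by simp) _) (mdifferentiableAt_extChartAt_symm' hy))).trans ?_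
  exact congrArg (mfderiv 𝓘(ℝ, W) 𝓘(ℝ, ℂ) φ _) (mfderiv_symm_chartFrame x₀ hy ξ)

theorem mpullback_symm_mulInvariantVectorField (x₀ : G) {y : W}
    (hy : y ∈ (extChartAt 𝓘(ℝ, W) x₀).target) (ξ : GroupLieAlgebra 𝓘(ℝ, W) G) :
    mpullback 𝓘(ℝ, W) 𝓘(ℝ, W) (extChartAt 𝓘(ℝ, W) x₀).symm (mulInvariantVectorField ξ) y =
      chartFrame x₀ y ξ := by
  rw [mpullback_apply, ← mfderiv_symm_chartFrame x₀ hy ξ]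
  exact (isInvertible_mfderiv_extChartAt_symm' hy).inverse_apply_self _

theorem mlieBracket_eq_lieBracket (X Y : W → W) (y : W) :
    mlieBracket 𝓘(ℝ, W) X Y y = lieBracket ℝ X Y y := by
  have h1 := congrFun (mlieBracketWithin_eq_lieBracketWithin (𝕜 := ℝ) (V := X) (W := Y)
    (s := univ)) y
  have h2 := congrFun (lieBracketWithin_univ (𝕜 := ℝ) (V := X) (W := Y)) y
  exact (h1.trans h2 :)

/-- Pullback by the inverse chart commutes with brackets, and the bracket of two left-invariant
fields is the left-invariant field of the bracket. -/
theorem lieBracket_chartFrame [CompleteSpace W] (x₀ : G) {y : W}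
    (hy : y ∈ (extChartAt 𝓘(ℝ, W) x₀).target) (ξ η : GroupLieAlgebra 𝓘(ℝ, W) G) :
    lieBracket ℝ (fun z : W ↦ (chartFrame x₀ z ξ : W)) (fun z : W ↦ (chartFrame x₀ z η : W)) y =
      chartFrame x₀ y (⁅ξ, η⁆ : GroupLieAlgebra 𝓘(ℝ, W) G) := by
  have ho := (isOpen_extChartAt_target (I := 𝓘(ℝ, W)) x₀).mem_nhds hy
  have he (ζ : GroupLieAlgebra 𝓘(ℝ, W) G) :
      mpullback 𝓘(ℝ, W) 𝓘(ℝ, W) (extChartAt 𝓘(ℝ, W) x₀).symm (mulInvariantVectorField ζ) =ᶠ[𝓝 y]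
        fun z ↦ chartFrame x₀ z ζ := by
    filter_upwards [ho] with z hz using mpullback_symm_mulInvariantVectorField x₀ hz ζ
  have : IsManifold 𝓘(ℝ, W) (minSmoothness ℝ 3) G := by
    rw [minSmoothness_of_isRCLikeNormedField]; infer_instance
  have h := mpullback_mlieBracket (n := ∞) (f := (extChartAt 𝓘(ℝ, W) x₀).symm) (x₀ := y)
    (mdifferentiableAt_mulInvariantVectorField ξ) (mdifferentiableAt_mulInvariantVectorField η)
    ((contMDiffOn_extChartAt_symm x₀).contMDiffAt ho)
    (by rw [minSmoothness_of_isRCLikeNormedField]; exact_mod_cast ENat.LEInfty.out)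
  rw [← mulInvariantVector_mlieBracket, ← GroupLieAlgebra.bracket_def,
    mpullback_symm_mulInvariantVectorField x₀ hy,
    Filter.EventuallyEq.mlieBracket_vectorField_eq (he ξ) (he η)] at h
  exact (h.trans (mlieBracket_eq_lieBracket _ _ y)).symm

end LeftInvariant

/-! ### De Rham cohomology of the group through the left-invariant frame -/

section DeRham

open Set VectorField

theorem contMDiff_iff_comp_extChartAt_symm {W : Type*} [NormedAddCommGroup W] [NormedSpace ℝ W]
    {G : Type*} [TopologicalSpace G] [ChartedSpace W G] [IsManifold 𝓘(ℝ, W) ∞ G]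
    {F : Type*} [NormedAddCommGroup F] [NormedSpace ℝ F] {φ : G → F} :
    ContMDiff 𝓘(ℝ, W) 𝓘(ℝ, F) ∞ φ ↔ ∀ x₀ : G,
      ContDiffOn ℝ ∞ (φ ∘ (extChartAt 𝓘(ℝ, W) x₀).symm) (extChartAt 𝓘(ℝ, W) x₀).target := by
  refine ⟨fun h x₀ ↦ ?_, fun h x₀ ↦ ?_⟩
  · rw [← contMDiffOn_iff_contDiffOn]
    exact h.comp_contMDiffOn (contMDiffOn_extChartAt_symm x₀)
  · have h1 : ContMDiffAt 𝓘(ℝ, W) 𝓘(ℝ, F) ∞ ((φ ∘ (extChartAt 𝓘(ℝ, W) x₀).symm) ∘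
        extChartAt 𝓘(ℝ, W) x₀) x₀ :=
      ((h x₀).contDiffAt ((isOpen_extChartAt_target x₀).mem_nhds
        (mem_extChartAt_target x₀))).contMDiffAt.comp x₀ contMDiffAt_extChartAt
    refine h1.congr_of_eventuallyEq ?_
    filter_upwards [extChartAt_source_mem_nhds (I := 𝓘(ℝ, W)) x₀] with g hg
    exact (congrArg φ ((extChartAt 𝓘(ℝ, W) x₀).left_inv hg)).symm

variable {W : Type*} [NormedAddCommGroup W] [NormedSpace ℝ W]
  {G : Type*} [TopologicalSpace G] [ChartedSpace W G] [Group G]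

/-- The values of a one-form on a Lie group on the left-invariant vector fields. -/
noncomputable def FormField.onLeftInv [LieGroup 𝓘(ℝ, W) ∞ G] (θ : FormField W G 1 ℂ) :
    GroupLieAlgebra 𝓘(ℝ, W) G →ₗ[ℝ] (G → ℂ) where
  toFun ξ g := θ g (fun _ ↦ mulInvariantVectorField ξ g)
  map_add' ξ η := by
    ext g
    exact (((ContinuousAlternatingMap.ofSubsingleton ℝ (TangentSpace 𝓘(ℝ, W) g) ℂ
      (0 : Fin 1)).symm (θ g)).comp (mfderiv 𝓘(ℝ, W) 𝓘(ℝ, W) (fun k : G ↦ g * k) 1)).map_add ξ η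
  map_smul' c ξ := by
    ext g
    exact (((ContinuousAlternatingMap.ofSubsingleton ℝ (TangentSpace 𝓘(ℝ, W) g) ℂ
      (0 : Fin 1)).symm (θ g)).comp (mfderiv 𝓘(ℝ, W) 𝓘(ℝ, W) (fun k : G ↦ g * k) 1)).map_smul c ξ

/-- A smooth one-cochain on the Lie algebra of `G` with values in the functions on `G`, closed
for the action by left-invariant derivatives. -/
structure IsLeftInvCocycle [LieGroup 𝓘(ℝ, W) ∞ G] [CompleteSpace W]
    (a : GroupLieAlgebra 𝓘(ℝ, W) G →ₗ[ℝ] (G → ℂ)) : Prop where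
  contMDiff : ∀ ξ, ContMDiff 𝓘(ℝ, W) 𝓘(ℝ, ℂ) ∞ (a ξ)
  closed : ∀ ξ η g, leftInvDeriv ξ (a η) g - leftInvDeriv η (a ξ) g = a ⁅ξ, η⁆ g

variable [LieGroup 𝓘(ℝ, W) ∞ G]

theorem inChart_chartFrame (θ : FormField W G 1 ℂ) (x₀ : G) {y : W}
    (hy : y ∈ (extChartAt 𝓘(ℝ, W) x₀).target) (ξ : GroupLieAlgebra 𝓘(ℝ, W) G) :
    θ.inChart x₀ y (fun _ ↦ chartFrame x₀ y ξ) =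
      θ.onLeftInv ξ ((extChartAt 𝓘(ℝ, W) x₀).symm y) := by
  refine congrArg (θ ((extChartAt 𝓘(ℝ, W) x₀).symm y)) ?_
  ext i
  exact mfderiv_symm_chartFrame x₀ hy ξ

/-- The frame is smooth and invertible in each chart, so passing between coordinate components and
frame components preserves smoothness in both directions. -/
theorem isSmooth_iff_onLeftInv [FiniteDimensional ℝ W] (θ : FormField W G 1 ℂ) :
    θ.IsSmooth ↔ ∀ ξ, ContMDiff 𝓘(ℝ, W) 𝓘(ℝ, ℂ) ∞ (θ.onLeftInv ξ) := by
  have : CompleteSpace W := FiniteDimensional.complete ℝ W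
  let I := ContinuousAlternatingMap.ofSubsingletonLIE (𝕜 := ℝ) (E := W) (F := ℂ) (0 : Fin 1)
  constructor
  · intro h ξ
    refine contMDiff_iff_comp_extChartAt_symm.2 fun x₀ ↦ ?_
    have h1 := I.symm.contDiff.comp_contDiffOn (h x₀)
    have h2 := h1.clm_apply ((contDiffOn_chartFrame x₀).clm_apply
      (contDiffOn_const (c := (show W from ξ))))
    refine h2.congr fun y hy ↦ ?_
    refine (inChart_chartFrame θ x₀ hy ξ).symm.trans ?_
    rfl
  · intro h x₀
    -- `B` holds the frame components; the coordinate form is `B` composed with the inverse frame.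
    let B (y : W) : W →L[ℝ] ℂ := LinearMap.toContinuousLinearMap
      ((LinearMap.proj ((extChartAt 𝓘(ℝ, W) x₀).symm y)).comp θ.onLeftInv)
    have hB : ContDiffOn ℝ ∞ B (extChartAt 𝓘(ℝ, W) x₀).target := by
      rw [contDiffOn_clm_apply]
      exact fun ξ ↦ contMDiff_iff_comp_extChartAt_symm.1 (h ξ) x₀
    have hC : ContDiffOn ℝ ∞ (fun y ↦ (chartFrame (W := W) x₀ y).inverse)
        (extChartAt 𝓘(ℝ, W) x₀).target := fun y hy ↦
      (isInvertible_chartFrame x₀ hy).contDiffAt_map_inverse.comp_contDiffWithinAt y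
        (contDiffOn_chartFrame x₀ y hy)
    refine (I.contDiff.comp_contDiffOn (hB.clm_comp hC)).congr fun y hy ↦ ?_
    ext v
    obtain ⟨w, hw⟩ := (isInvertible_chartFrame x₀ hy).bijective.2 (v 0)
    have hv : v = fun _ ↦ chartFrame x₀ y w := by
      ext i; rw [Subsingleton.elim i 0, hw]
    have h3 : (I (B y ∘L (chartFrame (W := W) x₀ y).inverse)) v =
        B y ((chartFrame (W := W) x₀ y).inverse (v 0)) := rfl
    refine Eq.trans ?_ h3.symm
    rw [← hw, (isInvertible_chartFrame x₀ hy).inverse_apply_self, hv]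
    exact inChart_chartFrame θ x₀ hy w

/-- Cartan's formula dθ(X, Y) = Xθ(Y) - Yθ(X) - θ([X, Y]) for two fields of the frame, whose bracket
is known from `lieBracket_chartFrame`. -/
theorem extDeriv_inChart_chartFrame [FiniteDimensional ℝ W] [CompleteSpace W] {θ : FormField W G 1 ℂ}
    (h : θ.IsSmooth)
    (x₀ : G) {y : W} (hy : y ∈ (extChartAt 𝓘(ℝ, W) x₀).target)
    (ξ η : GroupLieAlgebra 𝓘(ℝ, W) G) :
    extDeriv (θ.inChart x₀) y ![(chartFrame x₀ y ξ : W), chartFrame x₀ y η] =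
      leftInvDeriv ξ (θ.onLeftInv η) ((extChartAt 𝓘(ℝ, W) x₀).symm y) -
        leftInvDeriv η (θ.onLeftInv ξ) ((extChartAt 𝓘(ℝ, W) x₀).symm y) -
        θ.onLeftInv ⁅ξ, η⁆ ((extChartAt 𝓘(ℝ, W) x₀).symm y) := by
  have ho := (isOpen_extChartAt_target (I := 𝓘(ℝ, W)) x₀).mem_nhds hy
  have hd (ζ : W) : DifferentiableAt ℝ (fun z : W ↦ (chartFrame x₀ z ζ : W)) y :=
    ((((contDiffOn_chartFrame x₀).clm_apply contDiffOn_const).contDiffAt ho).differentiableAt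
      (by simp))
  have hV (i : Fin 2) : DifferentiableAt ℝ ((![fun z : W ↦ (chartFrame x₀ z ξ : W),
      fun z : W ↦ (chartFrame x₀ z η : W)] : Fin 2 → W → W) i) y := by
    fin_cases i
    exacts [hd ξ, hd η]
  have h1 := extDeriv_apply_vectorField (h.differentiableAt x₀ hy) hV
  have he (ζ : GroupLieAlgebra 𝓘(ℝ, W) G) : (fun z : W ↦ θ.inChart x₀ z (fun _ ↦ (chartFrame x₀ z ζ : W)))
      =ᶠ[𝓝 y] (θ.onLeftInv ζ) ∘ (extChartAt 𝓘(ℝ, W) x₀).symm := by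
    filter_upwards [ho] with z hz using inChart_chartFrame θ x₀ hz ζ
  have hs := (isSmooth_iff_onLeftInv θ).1 h
  rw [← fderiv_comp_symm_chartFrame x₀ hy (hs _), ← fderiv_comp_symm_chartFrame x₀ hy (hs _),
    ← (he _).fderiv_eq, ← (he _).fderiv_eq, ← inChart_chartFrame θ x₀ hy,
    ← lieBracket_chartFrame x₀ hy]
  have e0 (X Y : W → W) (z : W) : (0 : Fin 2).removeNth (fun i ↦ (![X, Y] : Fin 2 → W → W) i z) =
      fun _ : Fin 1 ↦ Y z := by
    ext i; rw [Subsingleton.elim i 0]; rfl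
  have e1 (X Y : W → W) (z : W) : (1 : Fin 2).removeNth (fun i ↦ (![X, Y] : Fin 2 → W → W) i z) =
      fun _ : Fin 1 ↦ X z := by
    ext i; rw [Subsingleton.elim i 0]; rfl
  have e2 (X Y : W → W) (z : W) : (fun i ↦ (![X, Y] : Fin 2 → W → W) i z) = ![X z, Y z] := by
    ext i; fin_cases i <;> rfl
  have e3 (X Y : W → W) (v : Fin 0 → W) :
      Matrix.vecCons (lieBracket ℝ X Y y) v = fun _ : Fin 1 ↦ lieBracket ℝ X Y y := by
    ext i; rw [Subsingleton.elim i 0]; rfl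
  rw [e2, Fin.sum_univ_two] at h1
  simp only [e0, e1, e3] at h1
  refine h1.trans ?_
  simp [sub_eq_add_neg]

/-- Vanishing of the first de Rham cohomology of a Lie group in terms of left-invariant
derivatives. -/
theorem subsingleton_deRhamH1_iff [FiniteDimensional ℝ W] [CompleteSpace W] :
    Subsingleton (DeRhamH1 W G) ↔ ∀ a : GroupLieAlgebra 𝓘(ℝ, W) G →ₗ[ℝ] (G → ℂ),
      IsLeftInvCocycle a → ∃ φ : G → ℂ, ContMDiff 𝓘(ℝ, W) 𝓘(ℝ, ℂ) ∞ φ ∧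
        ∀ ξ g, leftInvDeriv ξ φ g = a ξ g := by
  -- The form with prescribed values on the frame is obtained at g by undoing the derivative of left
  -- translation by g.
  have hform (a : GroupLieAlgebra 𝓘(ℝ, W) G →ₗ[ℝ] (G → ℂ)) :
      ∃ θ : FormField W G 1 ℂ, θ.onLeftInv = a := by
    choose l hl using fun g : G ↦ isInvertible_mfderiv_mul_left (W := W) g
    let l' (g : G) : W ≃L[ℝ] W := l g
    refine ⟨fun g ↦ (ContinuousAlternatingMap.ofSubsingleton ℝ W ℂ (0 : Fin 1)
      (LinearMap.toContinuousLinearMap (((LinearMap.proj g).comp a).comp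
        (l' g).symm.toLinearMap)) : W [⋀^Fin 1]→L[ℝ] ℂ), ?_⟩
    ext ξ g
    have : (l' g).symm (mulInvariantVectorField (I := 𝓘(ℝ, W)) ξ g) = ξ :=
      (l' g).symm_apply_eq.2 (congrArg (fun L ↦ L ξ) (hl g).symm)
    exact congrArg (fun ζ ↦ a ζ g) this
  have hext {θ θ' : FormField W G 1 ℂ} (h : θ.onLeftInv = θ'.onLeftInv) : θ = θ' := by
    funext g
    ext v
    obtain ⟨ξ, hξ⟩ := exists_mulInvariantVectorField_eq (W := W) g (v 0)
    have hv : v = fun _ ↦ mulInvariantVectorField ξ g := by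
      ext i; rw [Subsingleton.elim i 0, hξ]
    rw [hv]
    exact congrFun (congrArg (fun L ↦ L ξ) h) g
  have hclosed (θ : FormField W G 1 ℂ) :
      θ ∈ closedOneForms W G ↔ IsLeftInvCocycle θ.onLeftInv := by
    constructor
    · rintro ⟨h1, h2⟩
      refine ⟨(isSmooth_iff_onLeftInv θ).1 h1, fun ξ η g ↦ ?_⟩
      have h := extDeriv_inChart_chartFrame h1 g (mem_extChartAt_target g) ξ η
      rw [h2 g _ (mem_extChartAt_target g), extChartAt_to_inv] at h
      exact sub_eq_zero.1 h.symm
    · intro h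
      have h1 := (isSmooth_iff_onLeftInv θ).2 h.contMDiff
      refine ⟨h1, fun x₀ y hy ↦ ?_⟩
      ext v
      -- The frame spans every tangent space, so the exterior derivative vanishes once it vanishes
      -- on pairs of frame vectors.
      obtain ⟨ξ, hξ⟩ := (isInvertible_chartFrame x₀ hy).bijective.2 (v 0)
      obtain ⟨η, hη⟩ := (isInvertible_chartFrame x₀ hy).bijective.2 (v 1)
      have hv : v = ![(chartFrame x₀ y ξ : W), chartFrame x₀ y η] := by
        ext i; fin_cases i
        exacts [hξ.symm, hη.symm]
      rw [hv]
      exact (extDeriv_inChart_chartFrame h1 x₀ hy ξ η).trans (sub_eq_zero.2 (h.closed ξ η _))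
  rw [Submodule.Quotient.subsingleton_iff, Submodule.submoduleOf_eq_top]
  constructor
  · intro h a ha
    obtain ⟨θ, rfl⟩ := hform a
    obtain ⟨φ, hφ⟩ := h ((hclosed θ).2 ha)
    exact ⟨φ, φ.contMDiff, fun ξ g ↦ by rw [← hφ]; rfl⟩
  · intro h θ hθ
    obtain ⟨φ, hφ, hφ'⟩ := h _ ((hclosed θ).1 hθ)
    refine ⟨⟨φ, hφ⟩, hext ?_⟩
    ext ξ g
    exact hφ' ξ g

end DeRham

/-! ### Differentiation under the integral over a compact set -/

section ParametricIntegral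

open Set MeasureTheory

variable {E : Type} [NormedAddCommGroup E] [NormedSpace ℝ E]
  {H : Type*} [NormedAddCommGroup H] [NormedSpace ℝ H]
  {X : Type*} [TopologicalSpace X] [ChartedSpace H X]

/-- The partial derivative is a smooth function on the same open set, now with values in `E →L[ℝ]
F`; this is what lets differentiation under the integral be iterated. -/
theorem contMDiffOn_fderiv_left {F : Type*} [NormedAddCommGroup F] [NormedSpace ℝ F]
    [IsManifold 𝓘(ℝ, H) ∞ X] {Ω : Set (E × X)} (hΩ : IsOpen Ω) {Φ : E × X → F}
    (hΦ : ContMDiffOn (𝓘(ℝ, E).prod 𝓘(ℝ, H)) 𝓘(ℝ, F) ∞ Φ Ω) :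
    ContMDiffOn (𝓘(ℝ, E).prod 𝓘(ℝ, H)) 𝓘(ℝ, E →L[ℝ] F) ∞
      (fun p : E × X ↦ fderiv ℝ (fun u ↦ Φ (u, p.2)) p.1) Ω := by
  intro p hp
  have h1 : ContMDiffAt ((𝓘(ℝ, E).prod 𝓘(ℝ, H)).prod 𝓘(ℝ, E)) 𝓘(ℝ, F) ∞
      (Function.uncurry fun (q : E × X) (u : E) ↦ Φ (u, q.2)) (p, p.1) := by
    refine ContMDiffAt.comp (g := Φ) (f := fun q : (E × X) × E ↦ (q.2, q.1.2)) (p, p.1)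
      (hΦ.contMDiffAt (hΩ.mem_nhds hp)) ?_
    exact contMDiffAt_snd.prodMk (contMDiffAt_snd.comp _ contMDiffAt_fst)
  have h2 := ContMDiffAt.mfderiv (m := ∞) (fun (q : E × X) (u : E) ↦ Φ (u, q.2)) Prod.fst h1
    contMDiffAt_fst (by simp)
  have h4 (q : E × X) : fderiv ℝ (fun u ↦ Φ (u, q.2)) q.1 =
      mfderiv 𝓘(ℝ, E) 𝓘(ℝ, F) (fun u ↦ Φ (u, q.2)) q.1 := mfderiv_eq_fderiv.symm
  have h3 : (fun q : E × X ↦ fderiv ℝ (fun u ↦ Φ (u, q.2)) q.1) =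
      inTangentCoordinates 𝓘(ℝ, E) 𝓘(ℝ, F) Prod.fst (fun q : E × X ↦ Φ (q.1, q.2))
        (fun q : E × X ↦ mfderiv 𝓘(ℝ, E) 𝓘(ℝ, F) (fun u ↦ Φ (u, q.2)) q.1) p :=
    (funext h4).trans (inTangentCoordinates_model_space (I := 𝓘(ℝ, E))
      (I' := 𝓘(ℝ, F)) (Prod.fst : E × X → E) (fun q : E × X ↦ Φ (q.1, q.2)) _ p).symm
  rw [h3]
  exact h2.contMDiffWithinAt

variable [MeasurableSpace X] [OpensMeasurableSpace X] {μ : Measure X}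
  [IsFiniteMeasureOnCompacts μ] {K : Set X}

theorem hasFDerivAt_setIntegral_of_contMDiffOn {F : Type*} [NormedAddCommGroup F] [NormedSpace ℝ F]
    [IsManifold 𝓘(ℝ, H) ∞ X] (hK : IsCompact K) (hKm : MeasurableSet K)
    {Ω : Set (E × X)} (hΩ : IsOpen Ω) {Φ : E × X → F}
    (hΦ : ContMDiffOn (𝓘(ℝ, E).prod 𝓘(ℝ, H)) 𝓘(ℝ, F) ∞ Φ Ω) {u : E}
    (hu : ∀ x ∈ K, (u, x) ∈ Ω) :
    IntegrableOn (fun x ↦ fderiv ℝ (fun v ↦ Φ (v, x)) u) K μ ∧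
    HasFDerivAt (fun v ↦ ∫ x in K, Φ (v, x) ∂μ)
      (∫ x in K, fderiv ℝ (fun v ↦ Φ (v, x)) u ∂μ) u := by
  have hD := contMDiffOn_fderiv_left hΩ hΦ
  have hcont {F' : Type _} [TopologicalSpace F'] {Ψ : E × X → F'} (h : ContinuousOn Ψ Ω) (v : E)
      (hv : ∀ x ∈ K, (v, x) ∈ Ω) : ContinuousOn (fun x ↦ Ψ (v, x)) K :=
    h.comp (by fun_prop) hv
  have hcD := hcont hD.continuousOn u hu
  obtain ⟨C, hC⟩ := hK.exists_bound_of_continuousOn hcD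
  -- Allowing `C + 1` in place of `C` makes the bound an open condition, so the tube lemma extends
  -- it from `{u} ×ˢ K` to a neighbourhood, giving the constant dominating function.
  have hΩ' : IsOpen (Ω ∩ (fun p : E × X ↦ fderiv ℝ (fun v ↦ Φ (v, p.2)) p.1) ⁻¹'
      {L | ‖L‖ < C + 1}) :=
    hD.continuousOn.isOpen_inter_preimage hΩ (isOpen_lt continuous_norm continuous_const)
  obtain ⟨A, B, hA, hB, huA, hKB, hAB⟩ := generalized_tube_lemma (isCompact_singleton (x := u)) hK
    hΩ' (by
      rintro ⟨v, x⟩ ⟨rfl, hx⟩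
      exact ⟨hu x hx, (hC x hx).trans_lt (lt_add_one C)⟩)
  have hAn : A ∈ 𝓝 u := hA.mem_nhds (huA rfl)
  have hAΩ {v : E} (hv : v ∈ A) (x : X) (hx : x ∈ K) : (v, x) ∈ Ω := (hAB ⟨hv, hKB hx⟩).1
  have hmem : ∀ᵐ x ∂(μ.restrict K), x ∈ K := ae_restrict_mem hKm
  have hint := hcD.integrableOn_compact' (μ := μ) hK hKm
  refine ⟨hint, hasFDerivAt_integral_of_dominated_of_fderiv_le (μ := μ.restrict K)
    (F := fun v x ↦ Φ (v, x)) (F' := fun v x ↦ fderiv ℝ (fun w ↦ Φ (w, x)) v) (bound := fun _ ↦ C + 1) hAn ?_ ?_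
    hint.aestronglyMeasurable ?_ ?_ ?_⟩
  · filter_upwards [hAn] with v hv
    exact (hcont hΦ.continuousOn v (hAΩ hv)).aestronglyMeasurable_of_isCompact hK hKm
  · exact (hcont hΦ.continuousOn u hu).integrableOn_compact' hK hKm
  · filter_upwards [hmem] with x hx v hv
    exact (hAB (⟨hv, hKB hx⟩ : (v, x) ∈ A ×ˢ B)).2.le
  · exact integrableOn_const hK.measure_lt_top.ne
  · filter_upwards [hmem] with x hx v hv
    have h1 : ContMDiffAt 𝓘(ℝ, E) 𝓘(ℝ, F) ∞ (fun w ↦ Φ (w, x)) v :=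
      ContMDiffAt.comp (g := Φ) (f := fun w ↦ (w, x)) v
        (hΦ.contMDiffAt (hΩ.mem_nhds (hAΩ hv x hx))) (contMDiffAt_id.prodMk contMDiffAt_const)
    exact (h1.contDiffAt.differentiableAt (by simp)).hasFDerivAt

/-- Smooth dependence on parameters of the integral of a smooth function over a compact set. -/
theorem contDiffOn_setIntegral_of_contMDiffOn {F : Type} [NormedAddCommGroup F] [NormedSpace ℝ F]
    [IsManifold 𝓘(ℝ, H) ∞ X] (hK : IsCompact K) (hKm : MeasurableSet K)
    {Ω : Set (E × X)} (hΩ : IsOpen Ω) {Φ : E × X → F}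
    (hΦ : ContMDiffOn (𝓘(ℝ, E).prod 𝓘(ℝ, H)) 𝓘(ℝ, F) ∞ Φ Ω) {O : Set E} (hO : IsOpen O)
    (hu : ∀ u ∈ O, ∀ x ∈ K, (u, x) ∈ Ω) :
    ContDiffOn ℝ ∞ (fun v ↦ ∫ x in K, Φ (v, x) ∂μ) O := by
  rw [contDiffOn_infty]
  intro n
  -- The derivative is an integral of the same kind with values in `E →L[ℝ] F`, hence the
  -- generalization over `F`; with `E` and `F` both in `Type`, this space stays in `Type`.
  induction n generalizing F with
  | zero =>
    rw [Nat.cast_zero, contDiffOn_zero]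
    exact fun u hu' ↦ (hasFDerivAt_setIntegral_of_contMDiffOn hK hKm hΩ hΦ
      (hu u hu')).2.continuousAt.continuousWithinAt
  | succ n ih =>
    rw [Nat.cast_succ, contDiffOn_succ_iff_fderiv_of_isOpen hO]
    refine ⟨fun u hu' ↦ (hasFDerivAt_setIntegral_of_contMDiffOn hK hKm hΩ hΦ
      (hu u hu')).2.differentiableAt.differentiableWithinAt, by simp, ?_⟩
    refine (ih (contMDiffOn_fderiv_left hΩ hΦ)).congr fun u hu' ↦ ?_
    exact (hasFDerivAt_setIntegral_of_contMDiffOn hK hKm hΩ hΦ (hu u hu')).2.fderiv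

end ParametricIntegral

/-! ### Smoothness on the constraint surface via local retractions -/

section Retraction

open Set

/-- Near a regular zero, the zero set of a smooth map is a smooth retract. -/
theorem exists_contDiffOn_retraction {E F : Type*} [NormedAddCommGroup E] [NormedSpace ℝ E]
    [CompleteSpace E] [NormedAddCommGroup F] [NormedSpace ℝ F] [FiniteDimensional ℝ F]
    {j : E → F} {O : Set E} (hO : IsOpen O) (hj : ContDiffOn ℝ ∞ j O) {y₀ : E} (hy₀ : y₀ ∈ O)
    (h0 : j y₀ = 0) (hs : Function.Surjective (fderiv ℝ j y₀)) :
    ∃ (O' : Set E) (r : E → E), IsOpen O' ∧ y₀ ∈ O' ∧ O' ⊆ O ∧ ContDiffOn ℝ ∞ r O' ∧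
      (∀ y ∈ O', r y ∈ O ∧ j (r y) = 0) ∧ ∀ y ∈ O', j y = 0 → r y = y := by
  have : CompleteSpace F := FiniteDimensional.complete ℝ F
  obtain ⟨s, hsA⟩ := ContinuousLinearMap.exists_rightInverse_of_surjective (fderiv ℝ j y₀)
    (LinearMap.range_eq_top.2 hs)
  set A := fderiv ℝ j y₀ with hA
  have hsA' (w : F) : A (s w) = w := congrArg (fun L ↦ L w) hsA
  -- With s a right inverse of the derivative A, the equation j(y + s w) = 0 is solved for w near
  -- (y₀, 0) by inverting Φ. The retraction is y + s w(y), and w(y) = 0 when j(y) = 0.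
  let Φ : E × F → E × F := fun p ↦ (p.1, j (p.1 + s p.2))
  let D : Set (E × F) := (fun p : E × F ↦ p.1 + s p.2) ⁻¹' O
  have hD : IsOpen D := hO.preimage (by fun_prop)
  have hΦ : ContDiffOn ℝ ∞ Φ D := by
    refine contDiffOn_fst.prodMk (hj.comp (t := O) (ContDiff.contDiffOn ?_) fun p hp ↦ hp)
    fun_prop
  have ha : ((y₀, 0) : E × F) ∈ D := by simpa [D] using hy₀
  -- The derivative of Φ at (y₀, 0) is the shear (v, w) ↦ (v, A v + w), because A s = 1.
  let L : (E × F) ≃L[ℝ] (E × F) := ContinuousLinearEquiv.equivOfInverse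
    ((ContinuousLinearMap.fst ℝ E F).prod (A.comp (ContinuousLinearMap.fst ℝ E F) +
      ContinuousLinearMap.snd ℝ E F))
    ((ContinuousLinearMap.fst ℝ E F).prod (ContinuousLinearMap.snd ℝ E F -
      A.comp (ContinuousLinearMap.fst ℝ E F)))
    (fun p ↦ by ext <;> simp) (fun p ↦ by ext <;> simp)
  have hL : HasFDerivAt Φ (L : (E × F) →L[ℝ] (E × F)) (y₀, 0) := by
    have h1 : HasFDerivAt j A (y₀ + s 0) := by
      rw [map_zero, add_zero]
      exact ((hj.contDiffAt (hO.mem_nhds hy₀)).differentiableAt (by simp)).hasFDerivAt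
    have h2 : HasFDerivAt (fun p : E × F ↦ p.1 + s p.2)
        (ContinuousLinearMap.fst ℝ E F + s.comp (ContinuousLinearMap.snd ℝ E F)) (y₀, 0) :=
      (ContinuousLinearMap.fst ℝ E F + s.comp (ContinuousLinearMap.snd ℝ E F)).hasFDerivAt
    have h3 := (ContinuousLinearMap.fst ℝ E F).hasFDerivAt (x := ((y₀, 0) : E × F)).prodMk
      (HasFDerivAt.comp (y₀, 0) h1 h2)
    refine h3.congr_fderiv ?_
    ext p <;> simp [L, hsA']
  have hΦa : ContDiffAt ℝ ∞ Φ (y₀, 0) := hΦ.contDiffAt (hD.mem_nhds ha)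
  let e := hΦa.toOpenPartialHomeomorph Φ hL (by simp)
  have he (p : E × F) : e p = Φ p := rfl
  have hea : ((y₀, 0) : E × F) ∈ e.source := hΦa.mem_toOpenPartialHomeomorph_source hL (by simp)
  -- On `N` the derivative of Φ stays invertible, which makes the local inverse smooth on a
  -- neighbourhood of (y₀, 0) and not only at that point.
  let N : Set (E × F) := e.source ∩ (D ∩ fderiv ℝ Φ ⁻¹' range ((↑) : ((E × F) ≃L[ℝ] (E × F)) → _))
  have hN : IsOpen N := e.open_source.inter ((hΦ.continuousOn_fderiv_of_isOpen hD
    (by simp)).isOpen_inter_preimage hD ContinuousLinearEquiv.isOpen)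
  have haN : ((y₀, 0) : E × F) ∈ N := ⟨hea, ha, L, hL.fderiv.symm⟩
  have hT := e.isOpen_inter_preimage_symm hN
  have hea0 : e (y₀, 0) = (y₀, 0) := by simp [he, Φ, h0]
  have haT : ((y₀, 0) : E × F) ∈ e.target ∩ e.symm ⁻¹' N := by
    have h1 : ((y₀, 0) : E × F) ∈ e.target := by simpa [hea0] using e.map_source hea
    have h2 : e.symm (y₀, 0) = (y₀, 0) := by simpa [hea0] using e.left_inv hea
    exact ⟨h1, by rw [mem_preimage, h2]; exact haN⟩
  have hc : Continuous fun y : E ↦ ((y, 0) : E × F) := by fun_prop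
  refine ⟨O ∩ (fun y : E ↦ ((y, 0) : E × F)) ⁻¹' (N ∩ (e.target ∩ e.symm ⁻¹' N)),
    fun y ↦ (e.symm (y, 0)).1 + s (e.symm (y, 0)).2,
    hO.inter ((hN.inter hT).preimage hc), ⟨hy₀, haN, haT⟩, inter_subset_left, ?_, ?_, ?_⟩
  · rintro y ⟨-, -, hyT, hyN⟩
    obtain ⟨L', hL'⟩ := hyN.2.2
    have hd : ContDiffAt ℝ ∞ Φ (e.symm (y, 0)) := hΦ.contDiffAt (hD.mem_nhds hyN.2.1)
    have h1 : ContDiffAt ℝ ∞ e.symm (y, 0) := e.contDiffAt_symm hyT (f₀' := L')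
      (by rw [hL']; exact (hd.differentiableAt (by simp)).hasFDerivAt) hd
    have h2 : ContDiffAt ℝ ∞ (fun y : E ↦ e.symm (y, 0)) y :=
      ContDiffAt.comp y h1 (by fun_prop)
    exact (h2.fst.add (s.contDiff.contDiffAt.comp y h2.snd)).contDiffWithinAt
  · rintro y ⟨-, -, hyT, hyN⟩
    refine ⟨hyN.2.1, ?_⟩
    have := e.right_inv hyT
    rw [he] at this
    exact congrArg Prod.snd this
  · rintro y ⟨hyO, hyN, -⟩ hy
    have h1 : e (y, 0) = (y, 0) := by simp [he, Φ, hy]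
    have h2 : e.symm (y, 0) = (y, 0) := by simpa [h1] using e.left_inv hyN.1
    simp [h2]

variable {V : Type*} [NormedAddCommGroup V] [NormedSpace ℝ V]
  {G : Type*} [Group G] {M : Type*} [TopologicalSpace M] [ChartedSpace V M] [MulAction G M]

/-- Local extensions to `M` allow composition with any smooth map into `M` that lands in `C`,
without a manifold structure on `C`. -/
theorem smoothFunctions.contMDiffOn_comp {C : SubMulAction G M} (f : smoothFunctions V C)
    {B H' N : Type*} [NormedAddCommGroup B] [NormedSpace ℝ B] [TopologicalSpace H']
    {I : ModelWithCorners ℝ B H'} [TopologicalSpace N] [ChartedSpace H' N] {O : Set N} {p : N → C}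
    (hp : ContMDiffOn I 𝓘(ℝ, V) ∞ (fun y ↦ (p y : M)) O) :
    ContMDiffOn I 𝓘(ℝ, ℂ) ∞ (fun y ↦ f.1 (p y)) O := by
  intro y hy
  obtain ⟨U, o, m, F, hF, e⟩ := f.2 (p y)
  have h1 : ContMDiffWithinAt I 𝓘(ℝ, ℂ) ∞ (fun z ↦ F (p z)) O y :=
    (hF.contMDiffAt (o.mem_nhds m)).comp_contMDiffWithinAt y (hp y hy)
  refine h1.congr_of_eventuallyEq ?_ (e _ m).symm
  filter_upwards [(hp y hy).continuousWithinAt.preimage_mem_nhdsWithin (o.mem_nhds m)] with z hz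
  exact (e _ hz).symm

variable {W : Type*} [NormedAddCommGroup W] [NormedSpace ℝ W] [TopologicalSpace G]
  [ChartedSpace W G]

/-- A function on a regular constraint surface is smooth if its composition with every smooth map
from an open subset of the model space into the constraint surface is. -/
theorem HamiltonianGSpace.mem_smoothFunctions [CompleteSpace V] [FiniteDimensional ℝ W]
    [IsManifold 𝓘(ℝ, V) ∞ M] (S : HamiltonianGSpace V W G M) (hS : S.HasRegularConstraintSurface)
    {f : S.constraintSurface → ℂ}
    (hf : ∀ (O : Set V) (p : V → S.constraintSurface), IsOpen O →
      ContMDiffOn 𝓘(ℝ, V) 𝓘(ℝ, V) ∞ (fun y ↦ (p y : M)) O → ContDiffOn ℝ ∞ (fun y ↦ f (p y)) O) :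
    f ∈ smoothFunctions V S.constraintSurface := by
  intro c₀
  set φ := extChartAt 𝓘(ℝ, V) (c₀ : M)
  have hφo : IsOpen φ.target := isOpen_extChartAt_target (c₀ : M)
  have hj : ContDiffOn ℝ ∞ (S.momentum ∘ φ.symm) φ.target := by
    rw [← contMDiffOn_iff_contDiffOn]
    exact S.momentum_smooth.comp_contMDiffOn (contMDiffOn_extChartAt_symm (c₀ : M))
  have hJ0 (c : S.constraintSurface) : S.momentum c = 0 := c.2
  have hd : mfderiv 𝓘(ℝ, V) 𝓘(ℝ, StrongDual ℝ W) S.momentum (c₀ : M) =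
      fderiv ℝ (S.momentum ∘ φ.symm) (φ c₀) := by
    refine (if_pos (S.momentum_smooth.mdifferentiable (by simp) (c₀ : M))).trans ?_
    simp only [writtenInExtChartAt, modelWithCornersSelf_coe, range_id, fderivWithin_univ]
    rfl
  have hsurj : Function.Surjective (fderiv ℝ (S.momentum ∘ φ.symm) (φ c₀)) := by
    have := hS.2 c₀ c₀.2
    rw [hd] at this
    exact this
  obtain ⟨O, r, hO, hcO, hOt, hr, hr0, hrj⟩ := exists_contDiffOn_retraction hφo hj
    (mem_extChartAt_target (c₀ : M))
    (by simp only [Function.comp, φ, extChartAt_to_inv, hJ0]) hsurj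
  classical
  -- The retraction, corestricted to the surface; the value `c₀` outside its domain only makes `p`
  -- total.
  let p : V → S.constraintSurface := fun y ↦
    if h : S.momentum (φ.symm (r y)) = 0 then ⟨φ.symm (r y), h⟩ else c₀
  have hp {y : V} (hy : y ∈ O) : (p y : M) = φ.symm (r y) := by
    have : S.momentum (φ.symm (r y)) = 0 := (hr0 y hy).2
    simp only [p, dif_pos this]
  have hps : ContMDiffOn 𝓘(ℝ, V) 𝓘(ℝ, V) ∞ (fun y ↦ (p y : M)) O := by
    refine ContMDiffOn.congr ?_ fun y hy ↦ hp hy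
    exact (contMDiffOn_extChartAt_symm (c₀ : M)).comp (contMDiffOn_iff_contDiffOn.2 hr)
      fun y hy ↦ (hr0 y hy).1
  have hU := (continuousOn_extChartAt (I := 𝓘(ℝ, V)) (c₀ : M)).isOpen_inter_preimage
    (isOpen_extChartAt_source (c₀ : M)) hO
  -- The local extension of `f` is `f` after the retraction, which fixes the points of the surface.
  refine ⟨φ.source ∩ φ ⁻¹' O, hU, ⟨mem_extChartAt_source (c₀ : M), hcO⟩, fun x ↦ f (p (φ x)),
    ?_, ?_⟩
  · refine (hf O p hO hps).contMDiffOn.comp (contMDiffOn_extChartAt.mono fun x hx ↦ ?_)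
      fun x hx ↦ hx.2
    simpa [φ] using hx.1
  · intro y hy
    have h1 : r (φ y) = φ y := hrj _ hy.2 (by
      simp only [Function.comp, φ.left_inv hy.1, hJ0])
    refine congrArg f (Subtype.ext ?_)
    rw [hp hy.2, h1, φ.left_inv hy.1]

end Retraction

/-! ### Cutoff functions for a proper action -/

section Cutoff

open Set Function

variable {V : Type*} [NormedAddCommGroup V] [NormedSpace ℝ V]
  {G : Type*} [Group G]
  {M : Type*} [TopologicalSpace M] [ChartedSpace V M] [MulAction G M]

theorem smoothFunctions.continuous {C : SubMulAction G M} {f : C → ℂ}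
    (hf : f ∈ smoothFunctions V C) : Continuous f := by
  rw [continuous_iff_continuousAt]
  intro c
  obtain ⟨U, o, m, F, hF, e⟩ := hf c
  have h1 : ContinuousAt (fun y : C ↦ F y) c :=
    ((hF.contMDiffAt (o.mem_nhds m)).continuousAt).comp continuous_subtype_val.continuousAt
  refine h1.congr ?_
  filter_upwards [(o.preimage continuous_subtype_val).mem_nhds m] with y hy using e y hy

theorem smoothFunctions.mem_of_eventuallyEq {C : SubMulAction G M} {f : C → ℂ}
    (h : ∀ c : C, ∃ g ∈ smoothFunctions V C, f =ᶠ[𝓝 c] g) : f ∈ smoothFunctions V C := by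
  intro c
  obtain ⟨g, hg, hfg⟩ := h c
  obtain ⟨U, o, m, F, hF, e⟩ := hg c
  obtain ⟨t, ht, hto, hct⟩ := mem_nhds_iff.1 hfg
  obtain ⟨U', o', rfl⟩ := isOpen_induced_iff.1 hto
  refine ⟨U ∩ U', o.inter o', ⟨m, hct⟩, F, hF.mono inter_subset_left, fun y hy ↦ ?_⟩
  exact (e y hy.1).trans (ht hy.2).symm

variable [TopologicalSpace G]

variable (V) in
/-- Nonnegative smooth functions on `C` whose support meets the orbits of a compact set in a
compact set of group elements. -/
structure IsOrbitCutoff {C : SubMulAction G M} (b : C → ℝ) : Prop where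
  smooth : (fun c ↦ (b c : ℂ)) ∈ smoothFunctions V C
  nonneg : ∀ c, 0 ≤ b c
  proper : ∀ c₀ : C, ∃ Q ∈ 𝓝 c₀, ∃ K : Set G, IsCompact K ∧
    ∀ c ∈ Q, ∀ k ∉ K, b (k⁻¹ • c) = 0

theorem IsOrbitCutoff.continuous {C : SubMulAction G M} {b : C → ℝ} (hb : IsOrbitCutoff V b) :
    Continuous b :=
  Complex.continuous_re.comp (smoothFunctions.continuous hb.smooth)

variable [T2Space M] [FiniteDimensional ℝ V] [IsManifold 𝓘(ℝ, V) ∞ M] {C : SubMulAction G M}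

/-- A bump function on `M` has compact support, which meets the closed set `C` in a compact set T.
By properness the group elements carrying some point of T into a given compact neighbourhood Q form
a compact set. -/
theorem exists_isOrbitCutoff_of_mem_nhds (hC : IsClosed (C : Set M)) (hproper : ProperSMul G C)
    (c₀ : C) {N : Set C} (hN : N ∈ 𝓝 c₀) :
    ∃ b : C → ℝ, IsOrbitCutoff V b ∧ 0 < b c₀ ∧ ∀ c, b c ≠ 0 → c ∈ N := by
  have : LocallyCompactSpace M := Manifold.locallyCompact_of_finiteDimensional 𝓘(ℝ, V)
  have hCe : Topology.IsClosedEmbedding ((↑) : C → M) := hC.isClosedEmbedding_subtypeVal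
  have : LocallyCompactSpace C := hCe.locallyCompactSpace
  obtain ⟨t, ht, htN⟩ := mem_nhds_induced _ _ _ |>.1 hN
  obtain ⟨f, -, hft⟩ := (SmoothBumpFunction.nhds_basis_tsupport (I := 𝓘(ℝ, V)) (c₀ : M)).mem_iff.1 ht
  have hT : IsCompact (((↑) : C → M) ⁻¹' tsupport f) := hCe.isCompact_preimage f.hasCompactSupport
  refine ⟨fun c ↦ f c, ⟨fun c ↦ ⟨univ, isOpen_univ, mem_univ _, fun x ↦ (f x : ℂ), ?_,
    fun _ _ ↦ rfl⟩, fun c ↦ f.nonneg, fun c ↦ ?_⟩, ?_, fun c hc ↦ ?_⟩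
  · exact (Complex.ofRealCLM.contDiff.contMDiff.comp f.contMDiff).contMDiffOn
  · obtain ⟨Q, hQ, hQc⟩ := exists_compact_mem_nhds c
    refine ⟨Q, hQc, _, ProperSMul.isCompact_setOfPred_inter_nonempty hT hQ, fun y hy k hk ↦ ?_⟩
    by_contra h
    refine hk ⟨y, ⟨k⁻¹ • y, subset_tsupport _ h, ?_⟩, hy⟩
    simp
  · simp
  · exact htN (hft (subset_tsupport _ hc))

/-- A proper action on a closed subset of a second countable manifold admits a cutoff function
that does not vanish identically on any orbit. -/
theorem exists_isOrbitCutoff_orbit [SecondCountableTopology M] (hC : IsClosed (C : Set M))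
    (hproper : ProperSMul G C) :
    ∃ b : C → ℝ, IsOrbitCutoff V b ∧ ∀ c, ∃ k : G, 0 < b (k⁻¹ • c) := by
  have : LocallyCompactSpace M := Manifold.locallyCompact_of_finiteDimensional 𝓘(ℝ, V)
  have hCe : Topology.IsClosedEmbedding ((↑) : C → M) := hC.isClosedEmbedding_subtypeVal
  have : LocallyCompactSpace C := hCe.locallyCompactSpace
  have : SecondCountableTopology C := TopologicalSpace.Subtype.secondCountableTopology _
  let X := Quotient (MulAction.orbitRel G C)
  let π : C → X := Quotient.mk _
  have hπ : IsOpenQuotientMap π := MulAction.isOpenQuotientMap_quotientMk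
  have hπk (k : G) (c : C) : π (k • c) = π c := Quotient.sound (MulAction.mem_orbit c k)
  have : LocallyCompactSpace X := hπ.locallyCompactSpace
  have : T2Space X := t2Space_quotient_mulAction_of_properSMul
  have : SecondCountableTopology X :=
    TopologicalSpace.Quotient.secondCountableTopology isOpenMap_quotient_mk'_mul
  -- The images in the orbit space of the sets where a cutoff is nonzero form neighbourhood bases.
  -- The orbit space is locally compact, Hausdorff and second countable, so a locally finite cover
  -- by such images exists; the cutoffs are then summed.
  have hbasis (x : X) : (𝓝 x).HasBasis (fun b : C → ℝ ↦ IsOrbitCutoff V b ∧ x ∈ π '' support b)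
      fun b ↦ π '' support b := by
    refine ⟨fun t ↦ ⟨fun ht ↦ ?_, ?_⟩⟩
    · obtain ⟨c, rfl⟩ := hπ.surjective x
      obtain ⟨b, hb, hbc, hbt⟩ := exists_isOrbitCutoff_of_mem_nhds (V := V) hC hproper c
        (hπ.continuous.continuousAt.preimage_mem_nhds ht)
      refine ⟨b, ⟨hb, c, hbc.ne', rfl⟩, ?_⟩
      rintro _ ⟨c', hc', rfl⟩
      exact hbt c' hc'
    · rintro ⟨b, ⟨hb, hx⟩, hbt⟩
      exact Filter.mem_of_superset ((hπ.isOpenMap _ hb.continuous.isOpen_support).mem_nhds hx) hbt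
  obtain ⟨ι, x, r, hr, hcov, hfin⟩ := refinement_of_locallyCompact_sigmaCompact_of_nhds_basis hbasis
  -- Local finiteness in the orbit space yields a neighbourhood saturated by orbits, so one finite
  -- set of indices serves all translates k⁻¹c. This gives both smoothness and the properness
  -- condition for the sum.
  have hloc (c₀ : C) : ∃ T ∈ 𝓝 (π c₀), ∃ s : Finset ι, ∀ c, π c ∈ T → ∀ i ∉ s, r i c = 0 := by
    obtain ⟨T, hT, hTf⟩ := hfin (π c₀)
    refine ⟨T, hT, hTf.toFinset, fun c hc i hi ↦ ?_⟩
    by_contra h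
    exact hi (hTf.mem_toFinset.2 ⟨π c, ⟨c, h, rfl⟩, hc⟩)
  have hsum {c₀ : C} {T : Set X} {s : Finset ι} (hs : ∀ c, π c ∈ T → ∀ i ∉ s, r i c = 0) (c : C)
      (hc : π c ∈ T) : ∑ᶠ i, r i c = ∑ i ∈ s, r i c :=
    finsum_eq_sum_of_support_subset _ fun i hi ↦ by
      by_contra h
      exact hi (hs c hc i h)
  refine ⟨fun c ↦ ∑ᶠ i, r i c, ⟨?_, ?_, ?_⟩, ?_⟩
  · refine smoothFunctions.mem_of_eventuallyEq fun c₀ ↦ ?_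
    obtain ⟨T, hT, s, hs⟩ := hloc c₀
    refine ⟨∑ i ∈ s, fun c ↦ (r i c : ℂ), Submodule.sum_mem _ fun i _ ↦ (hr i).1.smooth, ?_⟩
    filter_upwards [hπ.continuous.continuousAt.preimage_mem_nhds hT] with c hc
    rw [hsum (c₀ := c₀) hs c hc]
    simp
  · exact fun c ↦ finsum_nonneg fun i ↦ (hr i).1.nonneg c
  · intro c₀
    obtain ⟨T, hT, s, hs⟩ := hloc c₀
    choose Q hQ K hK hQK using fun i ↦ (hr i).1.proper c₀
    refine ⟨π ⁻¹' T ∩ ⋂ i ∈ s, Q i, Filter.inter_mem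
      (hπ.continuous.continuousAt.preimage_mem_nhds hT) ((Filter.biInter_finset_mem s).2
        fun i _ ↦ hQ i), ⋃ i ∈ s, K i, s.isCompact_biUnion fun i _ ↦ hK i, fun c hc k hk ↦ ?_⟩
    rw [hsum (c₀ := c₀) hs _ (by rw [hπk]; exact hc.1)]
    refine Finset.sum_eq_zero fun i hi ↦ hQK i c (mem_iInter₂.1 hc.2 i hi) k fun hki ↦ hk ?_
    exact mem_iUnion₂.2 ⟨i, hi, hki⟩
  · intro c
    obtain ⟨i, c', hc', hcc'⟩ := mem_iUnion.1 (hcov.symm ▸ mem_univ (π c))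
    obtain ⟨g, hg⟩ := MulAction.orbitRel_apply.1 (Quotient.exact hcc')
    obtain ⟨T, hT, s, hs⟩ := hloc c'
    have hgc : g⁻¹ • c' = c := by rw [← hg]; simp
    refine ⟨g⁻¹, ?_⟩
    have : (g⁻¹)⁻¹ • c = c' := by rw [← hgc]; simp
    rw [this]
    refine lt_of_lt_of_eq ?_ (hsum (c₀ := c') hs c' (mem_of_mem_nhds hT)).symm
    have hi : i ∈ s := by
      by_contra h
      exact hc' (hs c' (mem_of_mem_nhds hT) i h)
    exact Finset.sum_pos' (fun i _ ↦ (hr i).1.nonneg c')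
      ⟨i, hi, ((hr i).1.nonneg c').lt_of_ne' hc'⟩

end Cutoff

/-! ### Left-invariant derivatives and propagation along a connected group -/

section LeftInvDeriv

open Set

theorem ContMDiffOn.complex_mul {B H' N : Type*} [NormedAddCommGroup B] [NormedSpace ℝ B]
    [TopologicalSpace H'] {I : ModelWithCorners ℝ B H'} [TopologicalSpace N] [ChartedSpace H' N]
    {O : Set N} {f g : N → ℂ} (hf : ContMDiffOn I 𝓘(ℝ, ℂ) ∞ f O)
    (hg : ContMDiffOn I 𝓘(ℝ, ℂ) ∞ g O) : ContMDiffOn I 𝓘(ℝ, ℂ) ∞ (fun x ↦ f x * g x) O :=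
  ContMDiff.comp_contMDiffOn (g := fun p : ℂ × ℂ ↦ p.1 * p.2)
    (contDiff_fst.mul contDiff_snd : ContDiff ℝ ∞ fun p : ℂ × ℂ ↦ p.1 * p.2).contMDiff
    (hf.prodMk_space hg)

variable {W : Type*} [NormedAddCommGroup W] [NormedSpace ℝ W]
  {G : Type*} [TopologicalSpace G] [ChartedSpace W G] [Group G]

theorem leftInvDeriv_const_mul {φ : G → ℂ} (hφ : ContMDiff 𝓘(ℝ, W) 𝓘(ℝ, ℂ) ∞ φ) (z : ℂ)
    (ξ : GroupLieAlgebra 𝓘(ℝ, W) G) (g : G) :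
    leftInvDeriv ξ (fun x ↦ z * φ x) g = z * leftInvDeriv ξ φ g := by
  have h := ((ContinuousLinearMap.mul ℝ ℂ z).hasMFDerivAt (x := φ g)).comp g
    (hφ.mdifferentiable (by simp) g).hasMFDerivAt
  exact congrArg (fun L ↦ L (mulInvariantVectorField ξ g)) h.mfderiv

theorem leftInvDeriv_add_const {φ : G → ℂ} (z : ℂ)
    (ξ : GroupLieAlgebra 𝓘(ℝ, W) G) (g : G) (hφ : ContMDiff 𝓘(ℝ, W) 𝓘(ℝ, ℂ) ∞ φ) :
    leftInvDeriv ξ (fun x ↦ φ x + z) g = leftInvDeriv ξ φ g := by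
  have h := ((ContinuousLinearMap.id ℝ ℂ).hasFDerivAt.add_const z).hasMFDerivAt.comp g
    (hφ.mdifferentiable (by simp) g).hasMFDerivAt
  exact congrArg (fun L ↦ L (mulInvariantVectorField ξ g)) h.mfderiv

variable [LieGroup 𝓘(ℝ, W) ∞ G]

theorem leftInvDeriv_comp_mul_left {φ : G → ℂ} (hφ : ContMDiff 𝓘(ℝ, W) 𝓘(ℝ, ℂ) ∞ φ) (k : G)
    (ξ : GroupLieAlgebra 𝓘(ℝ, W) G) (g : G) :
    leftInvDeriv ξ (fun x ↦ φ (k * x)) g = leftInvDeriv ξ φ (k * g) := by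
  have hL (q : G) : MDifferentiable 𝓘(ℝ, W) 𝓘(ℝ, W) (fun x : G ↦ q * x) :=
    (contMDiff_mul_left (n := ∞) (I := 𝓘(ℝ, W))).mdifferentiable (by simp)
  have h1 := mfderiv_comp_apply (f := fun x : G ↦ k * x) (g := φ) g
    (hφ.mdifferentiable (by simp) _) (hL k g) (mulInvariantVectorField ξ g)
  have h2 := mfderiv_comp_apply_of_eq (x := (1 : G)) (f := fun x : G ↦ g * x)
    (g := fun x : G ↦ k * x) (y := g) (hL k g) (hL g 1) (mul_one g) ξ
  have h3 : (fun x : G ↦ k * x) ∘ (fun x : G ↦ g * x) = fun x ↦ k * g * x := by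
    ext x; simp [mul_assoc]
  rw [h3] at h2
  exact h1.trans (congrArg (mfderiv 𝓘(ℝ, W) 𝓘(ℝ, ℂ) φ (k * g)) h2.symm)

theorem contMDiff_leftInvDeriv {φ : G → ℂ} (hφ : ContMDiff 𝓘(ℝ, W) 𝓘(ℝ, ℂ) ∞ φ)
    (ξ : GroupLieAlgebra 𝓘(ℝ, W) G) :
    ContMDiff 𝓘(ℝ, W) 𝓘(ℝ, ℂ) ∞ (leftInvDeriv ξ φ) := by
  refine contMDiff_iff_comp_extChartAt_symm.2 fun x₀ ↦ ?_
  have h1 := ((contMDiff_iff_comp_extChartAt_symm.1 hφ x₀).fderiv_of_isOpen (m := ∞)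
    (isOpen_extChartAt_target x₀) (by simp)).clm_apply
      ((contDiffOn_chartFrame x₀).clm_apply (contDiffOn_const (c := (show W from ξ))))
  exact h1.congr fun y hy ↦ (fderiv_comp_symm_chartFrame x₀ hy hφ ξ).symm

/-- The coordinate expression of the one-form with given values on the left-invariant fields. -/
noncomputable def cochainInChart [FiniteDimensional ℝ W]
    (a : GroupLieAlgebra 𝓘(ℝ, W) G →ₗ[ℝ] (G → ℂ)) (x₀ : G) (y : W) : W →L[ℝ] ℂ :=
  (LinearMap.toContinuousLinearMap (𝕜 := ℝ) (E := W)
    ((LinearMap.proj ((extChartAt 𝓘(ℝ, W) x₀).symm y)).comp a)).comp (chartFrame x₀ y).inverse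

theorem fderiv_eq_cochainInChart [FiniteDimensional ℝ W]
    {a : GroupLieAlgebra 𝓘(ℝ, W) G →ₗ[ℝ] (G → ℂ)} (x₀ : G) {y : W}
    (hy : y ∈ (extChartAt 𝓘(ℝ, W) x₀).target)
    {φ : G → ℂ} (hφ : ContMDiff 𝓘(ℝ, W) 𝓘(ℝ, ℂ) ∞ φ)
    (h : ∀ ξ, leftInvDeriv ξ φ ((extChartAt 𝓘(ℝ, W) x₀).symm y) =
      a ξ ((extChartAt 𝓘(ℝ, W) x₀).symm y)) :
    fderiv ℝ (φ ∘ (extChartAt 𝓘(ℝ, W) x₀).symm) y = cochainInChart a x₀ y := by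
  ext v
  obtain ⟨ξ, rfl⟩ := (isInvertible_chartFrame x₀ hy).bijective.2 v
  refine (fderiv_comp_symm_chartFrame x₀ hy hφ ξ).trans ((h ξ).trans ?_)
  exact congrArg (fun ζ ↦ a ζ ((extChartAt 𝓘(ℝ, W) x₀).symm y))
    ((isInvertible_chartFrame x₀ hy).inverse_apply_self ξ).symm

theorem cochainInChart_chartFrame [FiniteDimensional ℝ W]
    (a : GroupLieAlgebra 𝓘(ℝ, W) G →ₗ[ℝ] (G → ℂ)) (x₀ : G) {y : W}
    (hy : y ∈ (extChartAt 𝓘(ℝ, W) x₀).target) (ξ : GroupLieAlgebra 𝓘(ℝ, W) G) :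
    cochainInChart a x₀ y (chartFrame x₀ y ξ) = a ξ ((extChartAt 𝓘(ℝ, W) x₀).symm y) :=
  congrArg (fun ζ ↦ a ζ ((extChartAt 𝓘(ℝ, W) x₀).symm y))
    ((isInvertible_chartFrame x₀ hy).inverse_apply_self ξ)

/-- A property of points of a connected manifold that propagates within small coordinate balls
holds everywhere as soon as it holds somewhere. -/
theorem forall_of_propagates_in_ball {M : Type*} [TopologicalSpace M] [ChartedSpace W M]
    [PreconnectedSpace M] {P : M → Prop} {x : M} (hx : P x)
    (h : ∀ x₀ : M, ∀ ε > 0, Metric.closedBall (extChartAt 𝓘(ℝ, W) x₀ x₀) ε ⊆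
      (extChartAt 𝓘(ℝ, W) x₀).target →
      ∀ y ∈ Metric.ball (extChartAt 𝓘(ℝ, W) x₀ x₀) ε,
      ∀ z ∈ Metric.ball (extChartAt 𝓘(ℝ, W) x₀ x₀) ε,
        P ((extChartAt 𝓘(ℝ, W) x₀).symm y) → P ((extChartAt 𝓘(ℝ, W) x₀).symm z)) (x' : M) :
    P x' := by
  -- The induction is on the transitive relation `P a → P b`, needed in both directions between `x₀`
  -- and nearby points; hence the hypothesis for two arbitrary points of a ball.
  refine PreconnectedSpace.induction₂' (fun a b ↦ P a → P b) (fun x₀ ↦ ?_)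
    (⟨fun a b c hab hbc ha ↦ hbc (hab ha)⟩) x x' hx
  obtain ⟨ε, hε, hεt⟩ := Metric.nhds_basis_closedBall.mem_iff.1
    ((isOpen_extChartAt_target (I := 𝓘(ℝ, W)) x₀).mem_nhds (mem_extChartAt_target x₀))
  have h0 := Metric.mem_ball_self hε (x := extChartAt 𝓘(ℝ, W) x₀ x₀)
  have hb := (continuousAt_extChartAt (I := 𝓘(ℝ, W)) x₀).preimage_mem_nhds
    (Metric.ball_mem_nhds _ hε)
  filter_upwards [extChartAt_source_mem_nhds (I := 𝓘(ℝ, W)) x₀, hb] with z hz hzb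
  have h1 := h x₀ ε hε hεt _ h0 _ hzb
  have h2 := h x₀ ε hε hεt _ hzb _ h0
  rw [(extChartAt 𝓘(ℝ, W) x₀).left_inv hz, extChartAt_to_inv] at h1 h2
  exact ⟨h1, h2⟩

theorem eq_of_leftInvDeriv_eq_zero [ConnectedSpace G] {φ : G → ℂ}
    (hφ : ContMDiff 𝓘(ℝ, W) 𝓘(ℝ, ℂ) ∞ φ)
    (h : ∀ (ξ : GroupLieAlgebra 𝓘(ℝ, W) G) g, leftInvDeriv ξ φ g = 0) (g : G) : φ g = φ 1 := by
  refine forall_of_propagates_in_ball (W := W) (P := fun g ↦ φ g = φ 1) rfl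
    (fun x₀ ε hε hεt y hy z hz hP ↦ ?_) g
  have hb := Metric.ball_subset_closedBall.trans hεt
  rw [← hP]
  have hd : DifferentiableOn ℝ (φ ∘ (extChartAt 𝓘(ℝ, W) x₀).symm)
      (Metric.ball (extChartAt 𝓘(ℝ, W) x₀ x₀) ε) :=
    ((contMDiff_iff_comp_extChartAt_symm.1 hφ x₀).differentiableOn (by simp)).mono hb
  refine Metric.isOpen_ball.is_const_of_fderiv_eq_zero (convex_ball _ _).isPreconnected hd
    (fun w hw ↦ ?_) hz hy
  ext v
  obtain ⟨ξ, rfl⟩ := (isInvertible_chartFrame x₀ (hb hw)).bijective.2 v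
  exact (fderiv_comp_symm_chartFrame x₀ (hb hw) hφ ξ).trans (h ξ _)

end LeftInvDeriv

/-! ### Weighted averages of left translates -/

section Convolution

open Set MeasureTheory

variable {W : Type} [NormedAddCommGroup W] [NormedSpace ℝ W]
  {G : Type*} [TopologicalSpace G] [T2Space G] [ChartedSpace W G] [Group G]
  [LieGroup 𝓘(ℝ, W) ∞ G] [MeasurableSpace G] [BorelSpace G] (μ : Measure G)
  [IsFiniteMeasureOnCompacts μ]

/-- The weight is supported in the compact set `K`, so one may differentiate under the integral;
left-invariant derivatives commute with left translations. -/
theorem contMDiff_and_leftInvDeriv_convolution {w φ : G → ℂ} {K : Set G} (hK : IsCompact K)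
    (hw : ContMDiff 𝓘(ℝ, W) 𝓘(ℝ, ℂ) ∞ w) (hwK : ∀ k ∉ K, w k = 0)
    (hφ : ContMDiff 𝓘(ℝ, W) 𝓘(ℝ, ℂ) ∞ φ) :
    ContMDiff 𝓘(ℝ, W) 𝓘(ℝ, ℂ) ∞ (fun g ↦ ∫ k, w k * φ (k⁻¹ * g) ∂μ) ∧
    ∀ (ξ : GroupLieAlgebra 𝓘(ℝ, W) G) g, leftInvDeriv ξ (fun g ↦ ∫ k, w k * φ (k⁻¹ * g) ∂μ) g =
      ∫ k, w k * leftInvDeriv ξ φ (k⁻¹ * g) ∂μ := by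
  have hset (ψ : G → ℂ) (g : G) : ∫ k, w k * ψ (k⁻¹ * g) ∂μ = ∫ k in K, w k * ψ (k⁻¹ * g) ∂μ :=
    (setIntegral_eq_integral_of_forall_compl_eq_zero fun k hk ↦ by simp [hwK k hk]).symm
  simp only [hset]
  let Φ (x₀ : G) (p : W × G) : ℂ := w p.2 * φ (p.2⁻¹ * (extChartAt 𝓘(ℝ, W) x₀).symm p.1)
  let Ω (x₀ : G) : Set (W × G) := (extChartAt 𝓘(ℝ, W) x₀).target ×ˢ univ
  have hΩ (x₀ : G) : IsOpen (Ω x₀) := (isOpen_extChartAt_target x₀).prod isOpen_univ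
  have hΦ (x₀ : G) : ContMDiffOn (𝓘(ℝ, W).prod 𝓘(ℝ, W)) 𝓘(ℝ, ℂ) ∞ (Φ x₀) (Ω x₀) := by
    have h1 : ContMDiffOn (𝓘(ℝ, W).prod 𝓘(ℝ, W)) 𝓘(ℝ, W) ∞
        (fun p : W × G ↦ (extChartAt 𝓘(ℝ, W) x₀).symm p.1) (Ω x₀) :=
      (contMDiffOn_extChartAt_symm x₀).comp contMDiffOn_fst fun p hp ↦ hp.1
    have h2 : ContMDiffOn (𝓘(ℝ, W).prod 𝓘(ℝ, W)) 𝓘(ℝ, ℂ) ∞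
        (fun p : W × G ↦ φ (p.2⁻¹ * (extChartAt 𝓘(ℝ, W) x₀).symm p.1)) (Ω x₀) :=
      hφ.comp_contMDiffOn ((contMDiffOn_snd.inv).mul h1)
    exact (hw.comp_contMDiffOn contMDiffOn_snd).complex_mul h2
  have hs : ContMDiff 𝓘(ℝ, W) 𝓘(ℝ, ℂ) ∞ (fun g ↦ ∫ k in K, w k * φ (k⁻¹ * g) ∂μ) :=
    contMDiff_iff_comp_extChartAt_symm.2 fun x₀ ↦
      contDiffOn_setIntegral_of_contMDiffOn hK hK.measurableSet (hΩ x₀) (hΦ x₀)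
        (isOpen_extChartAt_target x₀) fun u hu k _ ↦ ⟨hu, mem_univ k⟩
  refine ⟨hs, fun ξ g ↦ ?_⟩
  have hy := mem_extChartAt_target (I := 𝓘(ℝ, W)) g
  have h1 := fderiv_comp_symm_chartFrame g hy hs ξ
  obtain ⟨hi, hd⟩ := hasFDerivAt_setIntegral_of_contMDiffOn (μ := μ) hK hK.measurableSet (hΩ g)
    (hΦ g) (u := extChartAt 𝓘(ℝ, W) g g) fun k _ ↦ ⟨hy, mem_univ k⟩
  rw [extChartAt_to_inv] at h1
  rw [← h1]
  refine (congrArg (fun L ↦ L (chartFrame g (extChartAt 𝓘(ℝ, W) g g) ξ)) hd.fderiv).trans ?_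
  refine (ContinuousLinearMap.integral_apply hi _).trans ?_
  refine integral_congr_ae (Filter.Eventually.of_forall fun k ↦ ?_)
  have hk : ContMDiff 𝓘(ℝ, W) 𝓘(ℝ, ℂ) ∞ fun x ↦ φ (k⁻¹ * x) := hφ.comp contMDiff_mul_left
  have h2 := fderiv_comp_symm_chartFrame g hy (contMDiffOn_univ.1
    ((contMDiffOn_const (c := w k)).complex_mul hk.contMDiffOn)) ξ
  rw [extChartAt_to_inv, leftInvDeriv_const_mul hk, leftInvDeriv_comp_mul_left hφ] at h2
  exact h2

end Convolution

/-! ### Averages over orbits -/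

section OrbitAverage

open Set MeasureTheory

variable {V : Type} [NormedAddCommGroup V] [NormedSpace ℝ V]
  {W : Type} [NormedAddCommGroup W] [NormedSpace ℝ W]
  {G : Type*} [TopologicalSpace G] [Group G]
  {M : Type*} [TopologicalSpace M] [ChartedSpace V M] [MulAction G M]

theorem HamiltonianGSpace.isClosed_constraintSurface [ChartedSpace W G]
    (S : HamiltonianGSpace V W G M) :
    IsClosed (S.constraintSurface : Set M) :=
  isClosed_singleton.preimage S.momentum_smooth.continuous

theorem IsOrbitCutoff.exists_isCompact {C : SubMulAction G M} {b : C → ℝ} (hb : IsOrbitCutoff V b)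
    (c : C) : ∃ K : Set G, IsCompact K ∧ ∀ k ∉ K, b (k⁻¹ • c) = 0 := by
  obtain ⟨Q, hQ, K, hK, h⟩ := hb.proper c
  exact ⟨K, hK, h c (mem_of_mem_nhds hQ)⟩

theorem IsOrbitCutoff.contMDiff_weight [ChartedSpace W G] [LieGroup 𝓘(ℝ, W) ∞ G]
    [ContMDiffSMul 𝓘(ℝ, W) 𝓘(ℝ, V) ∞ G M] {C : SubMulAction G M} {b : C → ℝ}
    (hb : IsOrbitCutoff V b) (c : C) :
    ContMDiff 𝓘(ℝ, W) 𝓘(ℝ, ℂ) ∞ (fun k : G ↦ (b (k⁻¹ • c) : ℂ)) :=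
  smoothFunctions.contMDiff_orbit_inv ⟨_, hb.smooth⟩ c

variable [MeasurableSpace G] (μ : Measure G)

/-- The integral of `Ψ` over the orbit through `c`, weighted by the cutoff function `b`. -/
noncomputable def orbitAverage {C : SubMulAction G M} (b : C → ℝ) (Ψ : C → G → ℂ) (c : C) : ℂ :=
  ∫ k, (b (k⁻¹ • c) : ℂ) * Ψ c k ∂μ

variable [BorelSpace G]

theorem IsOrbitCutoff.integrable [T2Space G] [ContinuousInv G] [IsFiniteMeasureOnCompacts μ]
    {C : SubMulAction G M} [ContinuousSMul G C] {b : C → ℝ}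
    (hb : IsOrbitCutoff V b) (c : C) {ψ : G → ℂ} (hψ : Continuous ψ) :
    Integrable (fun k ↦ (b (k⁻¹ • c) : ℂ) * ψ k) μ := by
  obtain ⟨K, hK, hbK⟩ := hb.exists_isCompact c
  have hbc : Continuous fun k : G ↦ b (k⁻¹ • c) :=
    hb.continuous.comp (continuous_inv.smul continuous_const)
  exact Continuous.integrable_of_hasCompactSupport ((Complex.continuous_ofReal.comp hbc).mul hψ)
    (HasCompactSupport.intro hK fun k hk ↦ by simp [hbK k hk])

theorem IsOrbitCutoff.integrable_weight [T2Space G] [ContinuousInv G] [IsFiniteMeasureOnCompacts μ]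
    {C : SubMulAction G M} [ContinuousSMul G C] {b : C → ℝ} (hb : IsOrbitCutoff V b) (c : C) :
    Integrable (fun k ↦ b (k⁻¹ • c)) μ := by
  obtain ⟨K, hK, hbK⟩ := hb.exists_isCompact c
  exact (hb.continuous.comp (continuous_inv.smul continuous_const)).integrable_of_hasCompactSupport
    (HasCompactSupport.intro hK hbK)

theorem IsOrbitCutoff.integral_weight_pos [T2Space G] [ContinuousInv G]
    [IsFiniteMeasureOnCompacts μ] [μ.IsOpenPosMeasure] {C : SubMulAction G M} [ContinuousSMul G C]
    {b : C → ℝ} (hb : IsOrbitCutoff V b) {c : C} {k : G} (hk : b (k⁻¹ • c) ≠ 0) :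
    0 < ∫ k, b (k⁻¹ • c) ∂μ := by
  obtain ⟨K, hK, hbK⟩ := hb.exists_isCompact c
  exact Continuous.integral_pos_of_hasCompactSupport_nonneg_nonzero
    (hb.continuous.comp (continuous_inv.smul continuous_const))
    (HasCompactSupport.intro hK hbK) (fun k ↦ hb.nonneg _) hk

variable [T2Space G] [ChartedSpace W G] [LieGroup 𝓘(ℝ, W) ∞ G]
  [ContMDiffSMul 𝓘(ℝ, W) 𝓘(ℝ, V) ∞ G M]

/-- Tested along a map `p` into the surface, the integral near a point runs over one compact set of
group elements, by the properness of the cutoff, so it depends smoothly on the parameter. -/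
theorem HamiltonianGSpace.orbitAverage_mem [IsFiniteMeasureOnCompacts μ] [CompleteSpace V]
    [FiniteDimensional ℝ W] [IsManifold 𝓘(ℝ, V) ∞ M] (S : HamiltonianGSpace V W G M)
    (hS : S.HasRegularConstraintSurface) {b : S.constraintSurface → ℝ} (hb : IsOrbitCutoff V b)
    {Ψ : S.constraintSurface → G → ℂ}
    (hΨ : ∀ (O : Set V) (p : V → S.constraintSurface), IsOpen O →
      ContMDiffOn 𝓘(ℝ, V) 𝓘(ℝ, V) ∞ (fun y ↦ (p y : M)) O →
      ContMDiffOn (𝓘(ℝ, V).prod 𝓘(ℝ, W)) 𝓘(ℝ, ℂ) ∞ (fun q : V × G ↦ Ψ (p q.1) q.2) (O ×ˢ univ)) :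
    orbitAverage μ b Ψ ∈ smoothFunctions V S.constraintSurface := by
  refine S.mem_smoothFunctions hS fun O p hO hp y₀ hy₀ ↦ ?_
  obtain ⟨Q, hQ, K, hK, hQK⟩ := hb.proper (p y₀)
  have hpc : ContinuousOn p O := Topology.IsInducing.subtypeVal.continuousOn_iff.2 hp.continuousOn
  obtain ⟨O', hO', hyO', hOQ⟩ : ∃ O', IsOpen O' ∧ y₀ ∈ O' ∧ O' ⊆ O ∩ p ⁻¹' Q := by
    have h1 := Filter.inter_mem (hO.mem_nhds hy₀)
      ((hpc.continuousAt (hO.mem_nhds hy₀)).preimage_mem_nhds hQ)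
    obtain ⟨t, ht, hto, hyt⟩ := mem_nhds_iff.1 h1
    exact ⟨t, hto, hyt, ht⟩
  have hw : ContMDiffOn (𝓘(ℝ, V).prod 𝓘(ℝ, W)) 𝓘(ℝ, ℂ) ∞
      (fun q : V × G ↦ (b (q.2⁻¹ • p q.1) : ℂ)) (O ×ˢ univ) := by
    refine smoothFunctions.contMDiffOn_comp (⟨_, hb.smooth⟩ : smoothFunctions V S.constraintSurface)
      (p := fun q : V × G ↦ q.2⁻¹ • p q.1) ?_
    have h1 : ContMDiffOn (𝓘(ℝ, V).prod 𝓘(ℝ, W)) 𝓘(ℝ, V) ∞ (fun q : V × G ↦ (p q.1 : M))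
        (O ×ˢ univ) := hp.comp contMDiffOn_fst fun q hq ↦ hq.1
    exact contMDiffOn_snd.inv.smul (I := 𝓘(ℝ, W)) h1
  -- The integral over the fixed set `K` is smooth on all of `O`, but agrees with the full orbit
  -- integral only on `O'`, where `p` takes values in `Q`.
  have h2 : ContDiffOn ℝ ∞ (fun y ↦ ∫ k in K, (b (k⁻¹ • p y) : ℂ) * Ψ (p y) k ∂μ) O :=
    contDiffOn_setIntegral_of_contMDiffOn hK hK.measurableSet (hO.prod isOpen_univ)
      (hw.complex_mul (hΨ O p hO hp)) hO fun u hu k _ ↦ ⟨hu, mem_univ k⟩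
  refine ((h2.contDiffAt (hO.mem_nhds hy₀)).congr_of_eventuallyEq ?_).contDiffWithinAt
  filter_upwards [hO'.mem_nhds hyO'] with y hy
  exact (setIntegral_eq_integral_of_forall_compl_eq_zero fun k hk ↦ by
    simp [hQK _ (hOQ hy).2 k hk]).symm

end OrbitAverage

/-! ### Smooth dependence of primitives on parameters -/

section Primitive

open Set MeasureTheory

variable {V : Type} [NormedAddCommGroup V] [NormedSpace ℝ V]
  {W : Type} [NormedAddCommGroup W] [NormedSpace ℝ W] [FiniteDimensional ℝ W]
  {G : Type*} [TopologicalSpace G] [ChartedSpace W G] [Group G] [LieGroup 𝓘(ℝ, W) ∞ G]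

/-- A family of primitives of closed one-forms on a connected Lie group, normalized at `1`, depends
smoothly on the parameters on which the forms depend smoothly. -/
theorem contMDiffOn_primitive [ConnectedSpace G] {O : Set V} (hO : IsOpen O)
    {a : V → GroupLieAlgebra 𝓘(ℝ, W) G →ₗ[ℝ] (G → ℂ)}
    (ha : ∀ ξ, ContMDiffOn (𝓘(ℝ, V).prod 𝓘(ℝ, W)) 𝓘(ℝ, ℂ) ∞ (fun q : V × G ↦ a q.1 ξ q.2)
      (O ×ˢ univ))
    {h : V → G → ℂ} (hs : ∀ y ∈ O, ContMDiff 𝓘(ℝ, W) 𝓘(ℝ, ℂ) ∞ (h y)) (h1 : ∀ y ∈ O, h y 1 = 0)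
    (hd : ∀ y ∈ O, ∀ ξ g, leftInvDeriv ξ (h y) g = a y ξ g) :
    ContMDiffOn (𝓘(ℝ, V).prod 𝓘(ℝ, W)) 𝓘(ℝ, ℂ) ∞ (fun q : V × G ↦ h q.1 q.2) (O ×ˢ univ) := by
  have : CompleteSpace W := FiniteDimensional.complete ℝ W
  have hform (x₀ : G) : ContDiffOn ℝ ∞ (fun q : V × W ↦ cochainInChart (a q.1) x₀ q.2)
      (O ×ˢ (extChartAt 𝓘(ℝ, W) x₀).target) := by
    refine ContDiffOn.clm_comp ?_ ?_
    · rw [contDiffOn_clm_apply]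
      intro ξ
      rw [← contMDiffOn_iff_contDiffOn, modelWithCornersSelf_prod, ← chartedSpaceSelf_prod]
      exact (ha ξ).comp (contMDiffOn_fst.prodMk ((contMDiffOn_extChartAt_symm x₀).comp
        contMDiffOn_snd fun q hq ↦ hq.2)) fun q hq ↦ ⟨hq.1, mem_univ _⟩
    · have h2 : ContDiffOn ℝ ∞ (fun q : V × W ↦ chartFrame x₀ q.2)
          (O ×ˢ (extChartAt 𝓘(ℝ, W) x₀).target) :=
        (contDiffOn_chartFrame x₀).comp contDiffOn_snd fun q hq ↦ hq.2
      exact fun q hq ↦ ContDiffAt.comp_contDiffWithinAt (f := fun q : V × W ↦ chartFrame x₀ q.2) q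
        (isInvertible_chartFrame x₀ hq.2).contDiffAt_map_inverse (h2 q hq)
  -- In a coordinate ball the primitive is its value at z₀ plus the integral of the form along the
  -- segment from z₀ to z. Smoothness in the parameter at one point thus gives joint smoothness on
  -- the ball.
  have hlocal (x₀ : G) (ε : ℝ) (hεt : Metric.closedBall (extChartAt 𝓘(ℝ, W) x₀ x₀) ε ⊆
      (extChartAt 𝓘(ℝ, W) x₀).target) (z₀ : W)
      (hz₀ : z₀ ∈ Metric.ball (extChartAt 𝓘(ℝ, W) x₀ x₀) ε)
      (hP : ContDiffOn ℝ ∞ (fun y ↦ h y ((extChartAt 𝓘(ℝ, W) x₀).symm z₀)) O) :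
      ContDiffOn ℝ ∞ (fun q : V × W ↦ h q.1 ((extChartAt 𝓘(ℝ, W) x₀).symm q.2))
        (O ×ˢ Metric.ball (extChartAt 𝓘(ℝ, W) x₀ x₀) ε) := by
    set φ := extChartAt 𝓘(ℝ, W) x₀ with hφ
    set B := Metric.ball (φ x₀) ε with hB
    have hBt : B ⊆ φ.target := Metric.ball_subset_closedBall.trans hεt
    let ℓ (q : (V × W) × ℝ) : W := z₀ + q.2 • (q.1.2 - z₀)
    have hℓ : ContDiff ℝ ∞ ℓ := by fun_prop
    let Ω : Set ((V × W) × ℝ) := {q | q.1.1 ∈ O ∧ ℓ q ∈ B}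
    have hΩ : IsOpen Ω := (hO.preimage (by fun_prop)).inter (Metric.isOpen_ball.preimage hℓ.continuous)
    let Φ (q : (V × W) × ℝ) : ℂ := cochainInChart (a q.1.1) x₀ (ℓ q) (q.1.2 - z₀)
    have hΦ : ContDiffOn ℝ ∞ Φ Ω := by
      have h3 : ContDiffOn ℝ ∞ (fun q ↦ cochainInChart (a q.1.1) x₀ (ℓ q)) Ω :=
        (hform x₀).comp (f := fun q : (V × W) × ℝ ↦ (q.1.1, ℓ q))
          (ContDiff.contDiffOn (by fun_prop)) fun q hq ↦ ⟨hq.1, hBt hq.2⟩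
      exact h3.clm_apply (ContDiff.contDiffOn (by fun_prop))
    have hΦ' : ContMDiffOn (𝓘(ℝ, V × W).prod 𝓘(ℝ, ℝ)) 𝓘(ℝ, ℂ) ∞ Φ Ω := by
      rw [← contMDiffOn_iff_contDiffOn, modelWithCornersSelf_prod (E := V × W),
        ← chartedSpaceSelf_prod] at hΦ
      exact hΦ
    have hseg {z : W} (hz : z ∈ B) {t : ℝ} (ht : t ∈ Icc (0 : ℝ) 1) : z₀ + t • (z - z₀) ∈ B :=
      (convex_ball _ _).add_smul_sub_mem hz₀ hz ht
    have hint := contDiffOn_setIntegral_of_contMDiffOn (μ := volume) isCompact_Icc measurableSet_Icc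
      hΩ hΦ' (hO.prod Metric.isOpen_ball) (K := Icc (0 : ℝ) 1)
      fun q hq t ht ↦ ⟨hq.1, hseg hq.2 ht⟩
    refine ((hP.comp contDiffOn_fst fun q hq ↦ hq.1).add hint).congr fun q hq ↦ ?_
    have hder (t : ℝ) (ht : t ∈ uIcc (0 : ℝ) 1) :
        HasDerivAt (fun t : ℝ ↦ h q.1 (φ.symm (z₀ + t • (q.2 - z₀)))) (Φ (q, t)) t := by
      rw [uIcc_of_le zero_le_one] at ht
      have ht' := hBt (hseg hq.2 ht)
      have h3 := ((contMDiff_iff_comp_extChartAt_symm.1 (hs _ hq.1) x₀).contDiffAt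
        ((isOpen_extChartAt_target x₀).mem_nhds ht')).differentiableAt (by simp) |>.hasFDerivAt
      rw [fderiv_eq_cochainInChart x₀ ht' (hs _ hq.1) fun ξ ↦ hd _ hq.1 ξ _] at h3
      have h4 : HasDerivAt (fun t : ℝ ↦ z₀ + t • (q.2 - z₀)) (q.2 - z₀) t := by
        simpa using ((hasDerivAt_id t).smul_const (q.2 - z₀)).const_add z₀
      exact h3.comp_hasDerivAt t h4
    have hcont : ContinuousOn (fun t ↦ Φ (q, t)) (uIcc (0 : ℝ) 1) := by
      rw [uIcc_of_le zero_le_one]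
      exact hΦ.continuousOn.comp (by fun_prop) fun t ht ↦ ⟨hq.1, hseg hq.2 ht⟩
    have hftc := intervalIntegral.integral_eq_sub_of_hasDerivAt hder hcont.intervalIntegrable
    rw [intervalIntegral.integral_of_le zero_le_one, ← integral_Icc_eq_integral_Ioc] at hftc
    simp only [one_smul, zero_smul, add_zero, add_sub_cancel] at hftc
    simp only [Function.comp_apply]
    rw [hftc]
    ring
  -- Smoothness in the parameter holds at g = 1, where all primitives vanish, and spreads over the
  -- connected group through `hlocal`.
  have hpoint (g : G) : ContDiffOn ℝ ∞ (fun y ↦ h y g) O := by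
    refine forall_of_propagates_in_ball (W := W) (P := fun g ↦ ContDiffOn ℝ ∞ (fun y ↦ h y g) O)
      (x := 1) (contDiffOn_const (c := (0 : ℂ)) |>.congr h1)
      (fun x₀ ε hε hεt y hy z hz hP ↦ ?_) g
    exact (hlocal x₀ ε hεt y hy hP).comp (contDiffOn_id.prodMk contDiffOn_const)
      fun v hv ↦ ⟨hv, hz⟩
  rintro ⟨y₀, g₀⟩ ⟨hy₀, -⟩
  obtain ⟨ε, hε, hεt⟩ := Metric.nhds_basis_closedBall.mem_iff.1
    ((isOpen_extChartAt_target (I := 𝓘(ℝ, W)) g₀).mem_nhds (mem_extChartAt_target g₀))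
  have h3 := (hlocal g₀ ε hεt _ (Metric.mem_ball_self hε) (hpoint _)).contMDiffOn
  have h4 : ContMDiffAt (𝓘(ℝ, V).prod 𝓘(ℝ, W)) 𝓘(ℝ, ℂ) ∞ (fun q : V × G ↦
      h q.1 ((extChartAt 𝓘(ℝ, W) g₀).symm (extChartAt 𝓘(ℝ, W) g₀ q.2))) (y₀, g₀) := by
    refine ContMDiffAt.comp (g := fun q : V × W ↦ h q.1 ((extChartAt 𝓘(ℝ, W) g₀).symm q.2))
      (f := fun q : V × G ↦ (q.1, extChartAt 𝓘(ℝ, W) g₀ q.2)) (y₀, g₀)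
      (h3.contMDiffAt ((hO.prod Metric.isOpen_ball).mem_nhds ⟨hy₀, Metric.mem_ball_self hε⟩)) ?_
    exact contMDiffAt_fst.prodMk_space (contMDiffAt_extChartAt.comp (y₀, g₀) contMDiffAt_snd)
  refine (h4.congr_of_eventuallyEq ?_).contMDiffWithinAt
  filter_upwards [continuous_snd.continuousAt.preimage_mem_nhds
    (extChartAt_source_mem_nhds (I := 𝓘(ℝ, W)) g₀)] with q hq
  exact congrArg (h q.1) ((extChartAt 𝓘(ℝ, W) g₀).left_inv hq).symm

end Primitive

/-! ### Restricting cochains on the surface to orbits -/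

section OrbitCochain

open Set

variable {V : Type} [NormedAddCommGroup V] [NormedSpace ℝ V]
  {W : Type} [NormedAddCommGroup W] [NormedSpace ℝ W]
  {G : Type*} [TopologicalSpace G] [ChartedSpace W G] [Group G]
  {M : Type*} [TopologicalSpace M] [ChartedSpace V M] [MulAction G M]

/-- The pullback of a one-cochain with values in `C^∞(C)` along `g ↦ g⁻¹ • c`. -/
noncomputable def orbitCochain {C : SubMulAction G M}
    (β : GroupLieAlgebra 𝓘(ℝ, W) G →ₗ[ℝ] smoothFunctions V C) (c : C) :
    GroupLieAlgebra 𝓘(ℝ, W) G →ₗ[ℝ] (G → ℂ) :=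
  (LinearMap.pi fun g : G ↦ LinearMap.proj (g⁻¹ • c)).comp
    ((smoothFunctions V C).subtype.comp β)

theorem orbitCochain_apply {C : SubMulAction G M}
    (β : GroupLieAlgebra 𝓘(ℝ, W) G →ₗ[ℝ] smoothFunctions V C) (c : C)
    (ξ : GroupLieAlgebra 𝓘(ℝ, W) G) (g : G) : orbitCochain β c ξ g = (β ξ).1 (g⁻¹ • c) := rfl

variable [IsManifold 𝓘(ℝ, V) ∞ M] [LieGroup 𝓘(ℝ, W) ∞ G] [ContMDiffSMul 𝓘(ℝ, W) 𝓘(ℝ, V) ∞ G M]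

/-- The inverse in g ↦ g⁻¹c absorbs the sign in ρ and converts the infinitesimal action into
left-invariant differentiation. -/
theorem leftInvDeriv_orbit {C : SubMulAction G M} (f : smoothFunctions V C) (c : C)
    (ξ : GroupLieAlgebra 𝓘(ℝ, W) G) (g : G) :
    leftInvDeriv ξ (fun k : G ↦ f.1 (k⁻¹ • c)) g = (⁅ξ, f⁆ : smoothFunctions V C).1 (g⁻¹ • c) :=
  smoothFunctions.bracket_apply_inv_smul ξ f c g

variable [CompleteSpace W] in
theorem isLeftInvCocycle_orbitCochain {C : SubMulAction G M}
    {β : GroupLieAlgebra 𝓘(ℝ, W) G →ₗ[ℝ] smoothFunctions V C}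
    (hβ : β ∈ LinearMap.ker (LieModule.Cohomology.d₁₂ ℝ (GroupLieAlgebra 𝓘(ℝ, W) G)
      (smoothFunctions V C))) (c : C) : IsLeftInvCocycle (orbitCochain β c) := by
  refine ⟨fun ξ ↦ smoothFunctions.contMDiff_orbit_inv (β ξ) c, fun ξ η g ↦ ?_⟩
  have h1 : ⁅ξ, β η⁆ - ⁅η, β ξ⁆ - β ⁅ξ, η⁆ = 0 := by
    rw [← LieModule.Cohomology.d₁₂_apply_apply, LinearMap.mem_ker.1 hβ]
    rfl
  have h2 := congrArg (fun f : smoothFunctions V C ↦ f.1 (g⁻¹ • c)) (sub_eq_zero.1 h1)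
  exact (congrArg₂ (· - ·) (leftInvDeriv_orbit (β η) c ξ g) (leftInvDeriv_orbit (β ξ) c η g)).trans h2

end OrbitCochain

/-! ### Vanishing for the group implies vanishing for the surface -/

section Backward

open Set MeasureTheory

variable {V : Type} [NormedAddCommGroup V] [NormedSpace ℝ V] [FiniteDimensional ℝ V]
  {W : Type} [NormedAddCommGroup W] [NormedSpace ℝ W] [FiniteDimensional ℝ W] [CompleteSpace W]
  {G : Type*} [TopologicalSpace G] [T2Space G] [ConnectedSpace G] [ChartedSpace W G] [Group G]
  [LieGroup 𝓘(ℝ, W) ∞ G]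
  {M : Type*} [TopologicalSpace M] [T2Space M] [SecondCountableTopology M] [ChartedSpace V M]
  [IsManifold 𝓘(ℝ, V) ∞ M] [MulAction G M] [ContMDiffSMul 𝓘(ℝ, W) 𝓘(ℝ, V) ∞ G M]

theorem HamiltonianGSpace.exists_ceDifferentialZero_eq (S : HamiltonianGSpace V W G M)
    (hS : S.HasRegularConstraintSurface) (hproper : ProperSMul G S.constraintSurface)
    (hG : ∀ a : GroupLieAlgebra 𝓘(ℝ, W) G →ₗ[ℝ] (G → ℂ), IsLeftInvCocycle a →
      ∃ φ : G → ℂ, ContMDiff 𝓘(ℝ, W) 𝓘(ℝ, ℂ) ∞ φ ∧ ∀ ξ g, leftInvDeriv ξ φ g = a ξ g)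
    {β : GroupLieAlgebra 𝓘(ℝ, W) G →ₗ[ℝ] smoothFunctions V S.constraintSurface}
    (hβ : β ∈ LinearMap.ker (LieModule.Cohomology.d₁₂ ℝ (GroupLieAlgebra 𝓘(ℝ, W) G)
      (smoothFunctions V S.constraintSurface))) :
    ∃ f, ceDifferentialZero ℝ (GroupLieAlgebra 𝓘(ℝ, W) G)
      (smoothFunctions V S.constraintSurface) f = β := by
  have : CompleteSpace V := FiniteDimensional.complete ℝ V
  have : IsTopologicalGroup G := topologicalGroup_of_lieGroup 𝓘(ℝ, W) ∞
  have : LocallyCompactSpace G := Manifold.locallyCompact_of_finiteDimensional 𝓘(ℝ, W)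
  let _ : MeasurableSpace G := borel G
  have : BorelSpace G := ⟨rfl⟩
  let μ : Measure G := Measure.haar
  have hprim (c : S.constraintSurface) : ∃ h : G → ℂ, ContMDiff 𝓘(ℝ, W) 𝓘(ℝ, ℂ) ∞ h ∧ h 1 = 0 ∧
      ∀ ξ g, leftInvDeriv ξ h g = orbitCochain β c ξ g := by
    obtain ⟨φ, hφ, hd⟩ := hG _ (isLeftInvCocycle_orbitCochain hβ c)
    refine ⟨fun g ↦ φ g + -φ 1, hφ.add contMDiff_const, add_neg_cancel _, fun ξ g ↦ ?_⟩
    rw [leftInvDeriv_add_const _ _ _ hφ, hd]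
  choose h hs h1 hd using hprim
  -- As functions of k, h_c(gk) and h_{g⁻¹c}(k) have the same left-invariant derivatives, so on the
  -- connected group they differ by their difference h_c(g) at k = 1.
  have hmul (c : S.constraintSurface) (g k : G) : h c (g * k) = h c g + h (g⁻¹ • c) k := by
    have hL : ContMDiff 𝓘(ℝ, W) 𝓘(ℝ, ℂ) ∞ (fun k ↦ h c (g * k)) := (hs c).comp contMDiff_mul_left
    have hneg : ContMDiff 𝓘(ℝ, W) 𝓘(ℝ, ℂ) ∞ (fun k ↦ -1 * h (g⁻¹ • c) k) :=
      contMDiffOn_univ.1 (contMDiffOn_const.complex_mul (hs _).contMDiffOn)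
    have := eq_of_leftInvDeriv_eq_zero (hL.add hneg) (fun ξ x ↦ ?_) k
    · simp only [mul_one, h1, Pi.add_apply] at this
      linear_combination this
    · have h2 : leftInvDeriv ξ ((fun k ↦ h c (g * k)) + fun k ↦ -1 * h (g⁻¹ • c) k) x =
          leftInvDeriv ξ (fun k ↦ h c (g * k)) x +
            leftInvDeriv ξ (fun k ↦ -1 * h (g⁻¹ • c) k) x :=
        congrArg (fun L ↦ L (mulInvariantVectorField ξ x)) (mfderiv_add
          (hL.mdifferentiable (by simp) x) (hneg.mdifferentiable (by simp) x))
      rw [h2, leftInvDeriv_comp_mul_left (hs c), leftInvDeriv_const_mul (hs _), hd, hd,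
        orbitCochain_apply, orbitCochain_apply, mul_inv_rev, mul_smul]
      ring
  obtain ⟨b, hb, hbpos⟩ := exists_isOrbitCutoff_orbit (V := V) S.isClosed_constraintSurface hproper
  have hsmooth (O : Set V) (p : V → S.constraintSurface) (hO : IsOpen O)
      (hp : ContMDiffOn 𝓘(ℝ, V) 𝓘(ℝ, V) ∞ (fun y ↦ (p y : M)) O) :
      ContMDiffOn (𝓘(ℝ, V).prod 𝓘(ℝ, W)) 𝓘(ℝ, ℂ) ∞ (fun q : V × G ↦ h (p q.1) q.2)
        (O ×ˢ univ) := by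
    refine contMDiffOn_primitive (a := fun y ↦ orbitCochain β (p y)) (h := fun y ↦ h (p y)) hO
      (fun ξ ↦ ?_) (fun y _ ↦ hs _) (fun y _ ↦ h1 _) (fun y _ ↦ hd _)
    refine smoothFunctions.contMDiffOn_comp (β ξ) (p := fun q : V × G ↦ q.2⁻¹ • p q.1) ?_
    exact contMDiffOn_snd.inv.smul (I := 𝓘(ℝ, W)) (hp.comp contMDiffOn_fst fun q hq ↦ hq.1)
  have hA := S.orbitAverage_mem μ hS hb hsmooth
  have hχ := S.orbitAverage_mem (Ψ := fun _ _ ↦ 1) μ hS hb fun _ _ _ _ ↦ contMDiffOn_const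
  set A := orbitAverage μ b h
  set χ := orbitAverage μ b fun _ _ ↦ 1
  have hχ0 (c : S.constraintSurface) : χ c ≠ 0 := by
    obtain ⟨k, hk⟩ := hbpos c
    have := hb.integral_weight_pos μ hk.ne'
    have h2 : χ c = ((∫ k, b (k⁻¹ • c) ∂μ : ℝ) : ℂ) := by
      rw [← integral_complex_ofReal]
      simp [χ, orbitAverage]
    rw [h2]
    exact_mod_cast this.ne'
  have hχg (c : S.constraintSurface) (g : G) : χ (g⁻¹ • c) = χ c := by
    have := integral_mul_left_eq_self (μ := μ) (fun k ↦ (b (k⁻¹ • c) : ℂ) * 1) g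
    simp only [mul_inv_rev, mul_smul] at this
    exact this
  -- By `hmul` the integrand for g⁻¹c is (h_c - h_c(g)) times the weight of c, evaluated at gk; left
  -- invariance of Haar measure removes the shift.
  have hAg (c : S.constraintSurface) (g : G) : A (g⁻¹ • c) = A c - h c g * χ c := by
    have h2 := integral_mul_left_eq_self (μ := μ)
      (fun k ↦ (b (k⁻¹ • c) : ℂ) * h c k - h c g * ((b (k⁻¹ • c) : ℂ) * 1)) g
    rw [integral_sub (hb.integrable μ c (hs c).continuous)
      ((hb.integrable μ c continuous_const).const_mul _), integral_const_mul] at h2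
    refine Eq.trans (integral_congr_ae (Filter.Eventually.of_forall fun k ↦ ?_)) h2
    simp only [hmul, mul_inv_rev, mul_smul]
    ring
  let f : smoothFunctions V S.constraintSurface := ⟨fun c ↦ -(A c / χ c), by
    refine S.mem_smoothFunctions hS fun O p hO hp ↦ ?_
    have e1 := (smoothFunctions.contMDiffOn_comp ⟨A, hA⟩ hp).contDiffOn
    have e2 := (smoothFunctions.contMDiffOn_comp ⟨χ, hχ⟩ hp).contDiffOn
    simp only [div_eq_mul_inv]
    exact (e1.mul (e2.inv fun y _ ↦ hχ0 _)).neg⟩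
  refine ⟨f, ?_⟩
  ext ξ c
  -- Along each orbit f is the primitive h_c up to a constant, so its derivative at g = 1 is β at c.
  have hfg : (fun g : G ↦ f.1 (g⁻¹ • c)) = fun g ↦ h c g + f.1 c := by
    ext g
    simp only [f, hAg, hχg]
    field_simp [hχ0 c]
    ring
  have h3 := leftInvDeriv_orbit f c ξ 1
  rw [hfg, leftInvDeriv_add_const _ _ _ (hs c), hd, orbitCochain_apply, inv_one, one_smul] at h3
  exact h3.symm

end Backward

/-! ### Limits of exact forms are exact -/

section Limit

open Set Filter TopologicalSpace

variable {W : Type*} [NormedAddCommGroup W] [NormedSpace ℝ W] [FiniteDimensional ℝ W]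
  {G : Type*} [TopologicalSpace G] [ChartedSpace W G] [Group G] [LieGroup 𝓘(ℝ, W) ∞ G]

theorem contDiffOn_inverse_chartFrame (x₀ : G) :
    ContDiffOn ℝ ∞ (fun y ↦ (chartFrame (W := W) x₀ y).inverse)
      (extChartAt 𝓘(ℝ, W) x₀).target :=
  have : CompleteSpace W := FiniteDimensional.complete ℝ W
  fun y hy ↦ (isInvertible_chartFrame x₀ hy).contDiffAt_map_inverse.comp_contDiffWithinAt y
    (contDiffOn_chartFrame x₀ y hy)

theorem contDiffOn_cochainInChart {a : GroupLieAlgebra 𝓘(ℝ, W) G →ₗ[ℝ] (G → ℂ)}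
    (ha : ∀ ξ, ContMDiff 𝓘(ℝ, W) 𝓘(ℝ, ℂ) ∞ (a ξ)) (x₀ : G) :
    ContDiffOn ℝ ∞ (cochainInChart a x₀) (extChartAt 𝓘(ℝ, W) x₀).target := by
  refine ContDiffOn.clm_comp ?_ (contDiffOn_inverse_chartFrame x₀)
  rw [contDiffOn_clm_apply]
  exact fun ξ ↦ contMDiff_iff_comp_extChartAt_symm.1 (ha ξ) x₀

/-- Passing from frame components to coordinates costs the norm of the inverse frame, which is
bounded on compact sets. -/
theorem norm_fderiv_sub_cochainInChart_le (a : GroupLieAlgebra 𝓘(ℝ, W) G →ₗ[ℝ] (G → ℂ)) (x₀ : G)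
    {y : W} (hy : y ∈ (extChartAt 𝓘(ℝ, W) x₀).target)
    {φ : G → ℂ} (hφ : ContMDiff 𝓘(ℝ, W) 𝓘(ℝ, ℂ) ∞ φ) {ε : ℝ} (hε : 0 ≤ ε)
    (h : ∀ ξ : W, ‖leftInvDeriv (ξ : GroupLieAlgebra 𝓘(ℝ, W) G) φ
      ((extChartAt 𝓘(ℝ, W) x₀).symm y) - a ξ ((extChartAt 𝓘(ℝ, W) x₀).symm y)‖ ≤ ε * ‖ξ‖) :
    ‖fderiv ℝ (φ ∘ (extChartAt 𝓘(ℝ, W) x₀).symm) y - cochainInChart a x₀ y‖ ≤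
      ε * ‖(chartFrame (W := W) x₀ y).inverse‖ := by
  have hinv := isInvertible_chartFrame (W := W) x₀ hy
  refine ContinuousLinearMap.opNorm_le_bound _ (by positivity) fun v ↦ ?_
  obtain ⟨ξ, rfl⟩ := hinv.bijective.2 v
  rw [sub_apply, fderiv_comp_symm_chartFrame x₀ hy hφ ξ,
    cochainInChart_chartFrame a x₀ hy ξ, mul_assoc]
  refine (h ξ).trans (mul_le_mul_of_nonneg_left ?_ hε)
  calc ‖ξ‖ = ‖(chartFrame x₀ y).inverse (chartFrame x₀ y ξ)‖ := by
        rw [hinv.inverse_apply_self]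
    _ ≤ _ := ContinuousLinearMap.le_opNorm _ _

/-- A one-cochain on a connected Lie group that is uniformly approximated on compact sets by
differentials of smooth functions is itself the differential of a smooth function. -/
theorem exists_primitive_of_approx [ConnectedSpace G]
    {a : GroupLieAlgebra 𝓘(ℝ, W) G →ₗ[ℝ] (G → ℂ)}
    (ha : ∀ ξ, ContMDiff 𝓘(ℝ, W) 𝓘(ℝ, ℂ) ∞ (a ξ))
    (h : ∀ Q : Set G, IsCompact Q → ∀ ε > 0, ∃ φ : G → ℂ, ContMDiff 𝓘(ℝ, W) 𝓘(ℝ, ℂ) ∞ φ ∧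
      ∀ g ∈ Q, ∀ ξ : W, ‖leftInvDeriv (ξ : GroupLieAlgebra 𝓘(ℝ, W) G) φ g - a ξ g‖ ≤ ε * ‖ξ‖) :
    ∃ φ : G → ℂ, ContMDiff 𝓘(ℝ, W) 𝓘(ℝ, ℂ) ∞ φ ∧ ∀ ξ g, leftInvDeriv ξ φ g = a ξ g := by
  -- The approximations are indexed by the directed set of pairs (compact set, error 1/(n+1)) and
  -- normalized at 1 so that their values, not only their derivatives, can converge.
  have hex (i : Compacts G × ℕ) : ∃ φ : G → ℂ, ContMDiff 𝓘(ℝ, W) 𝓘(ℝ, ℂ) ∞ φ ∧ φ 1 = 0 ∧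
      ∀ g ∈ i.1, ∀ ξ : W, ‖leftInvDeriv (ξ : GroupLieAlgebra 𝓘(ℝ, W) G) φ g - a ξ g‖ ≤
        1 / ((i.2 : ℝ) + 1) * ‖ξ‖ := by
    obtain ⟨φ, hφ, hd⟩ := h i.1 i.1.isCompact (1 / ((i.2 : ℝ) + 1)) Nat.one_div_pos_of_nat
    refine ⟨fun g ↦ φ g + -φ 1, hφ.add contMDiff_const, add_neg_cancel _, fun g hg ξ ↦ ?_⟩
    exact (congrArg (fun z ↦ ‖z - a ξ g‖) (leftInvDeriv_add_const _ _ _ hφ)).trans_le (hd g hg ξ)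
  choose φ hφ hφ1 hd using hex
  have hder (i : Compacts G × ℕ) (x₀ : G) {y : W} (hy : y ∈ (extChartAt 𝓘(ℝ, W) x₀).target) :
      HasFDerivAt (φ i ∘ (extChartAt 𝓘(ℝ, W) x₀).symm)
        (fderiv ℝ (φ i ∘ (extChartAt 𝓘(ℝ, W) x₀).symm) y) y :=
    (((contMDiff_iff_comp_extChartAt_symm.1 (hφ i) x₀).contDiffAt
      ((isOpen_extChartAt_target x₀).mem_nhds hy)).differentiableAt (by simp)).hasFDerivAt
  have hunif (x₀ : G) {y₀ : W} {ε : ℝ} (hεt : Metric.closedBall y₀ ε ⊆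
      (extChartAt 𝓘(ℝ, W) x₀).target) :
      TendstoUniformlyOn (fun i ↦ fderiv ℝ (φ i ∘ (extChartAt 𝓘(ℝ, W) x₀).symm))
        (cochainInChart a x₀) atTop (Metric.ball y₀ ε) := by
    have hK := isCompact_closedBall y₀ ε
    obtain ⟨D, hD⟩ := hK.exists_bound_of_continuousOn
      ((contDiffOn_inverse_chartFrame (W := W) x₀).continuousOn.mono hεt)
    let Q : Compacts G := ⟨_, hK.image_of_continuousOn
      ((continuousOn_extChartAt_symm (I := 𝓘(ℝ, W)) x₀).mono hεt)⟩
    rw [Metric.tendstoUniformlyOn_iff]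
    intro δ hδ
    have hlim : Tendsto (fun n : ℕ ↦ 1 / ((n : ℝ) + 1) * D) atTop (𝓝 0) := by
      simpa using tendsto_one_div_add_atTop_nhds_zero_nat.mul_const D
    obtain ⟨n, hn⟩ := eventually_atTop.1 (hlim.eventually (gt_mem_nhds hδ))
    filter_upwards [eventually_ge_atTop (Q, n)] with i hi y hy
    have hy' := Metric.ball_subset_closedBall hy
    rw [dist_comm, dist_eq_norm]
    refine (norm_fderiv_sub_cochainInChart_le a x₀ (hεt hy') (hφ i) (by positivity)
      (hd i _ (hi.1 ⟨y, hy', rfl⟩))).trans_lt ((mul_le_mul_of_nonneg_left (hD y hy')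
        (by positivity)).trans_lt (hn i.2 hi.2))
  -- At 1 the values are constantly 0; uniform convergence of derivatives on a ball propagates
  -- convergence from one of its points to all the others.
  have hcauchy (g : G) : Cauchy (map (fun i ↦ φ i g) atTop) := by
    refine forall_of_propagates_in_ball (W := W)
      (P := fun g ↦ Cauchy (map (fun i ↦ φ i g) atTop)) (x := 1) ?_ (fun x₀ ε hε hεt y hy z hz hP ↦ ?_) g
    · simp only [hφ1]
      exact (tendsto_const_nhds (x := (0 : ℂ))).cauchy_map
    · exact cauchy_map_of_uniformCauchySeqOn_fderiv Metric.isOpen_ball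
        (convex_ball _ _).isPreconnected (hunif x₀ hεt).uniformCauchySeqOn
        (fun i y hy ↦ hder i x₀ (hεt (Metric.ball_subset_closedBall hy))) hy hz hP
  choose ψ hψ using fun g ↦ cauchy_map_iff_exists_tendsto.1 (hcauchy g)
  have hψd (x₀ : G) {y : W} (hy : y ∈ (extChartAt 𝓘(ℝ, W) x₀).target) :
      HasFDerivAt (ψ ∘ (extChartAt 𝓘(ℝ, W) x₀).symm) (cochainInChart a x₀ y) y := by
    obtain ⟨ε, hε, hεt⟩ := Metric.nhds_basis_closedBall.mem_iff.1
      ((isOpen_extChartAt_target (I := 𝓘(ℝ, W)) x₀).mem_nhds hy)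
    exact hasFDerivAt_of_tendstoUniformlyOn Metric.isOpen_ball (hunif x₀ hεt)
      (fun i z hz ↦ hder i x₀ (hεt (Metric.ball_subset_closedBall hz))) (fun z _ ↦ hψ _)
      (Metric.mem_ball_self hε)
  -- The derivative of the limit is the given form, which is smooth, so the limit is smooth.
  have hψs : ContMDiff 𝓘(ℝ, W) 𝓘(ℝ, ℂ) ∞ ψ := by
    refine contMDiff_iff_comp_extChartAt_symm.2 fun x₀ ↦ ?_
    rw [contDiffOn_infty_iff_fderiv_of_isOpen (isOpen_extChartAt_target x₀)]
    exact ⟨fun y hy ↦ (hψd x₀ hy).differentiableAt.differentiableWithinAt,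
      (contDiffOn_cochainInChart ha x₀).congr fun y hy ↦ (hψd x₀ hy).fderiv⟩
  refine ⟨ψ, hψs, fun ξ g ↦ ?_⟩
  have hg := mem_extChartAt_target (I := 𝓘(ℝ, W)) g
  have h1 := fderiv_comp_symm_chartFrame g hg hψs ξ
  rw [(hψd g hg).fderiv, cochainInChart_chartFrame a g hg ξ, extChartAt_to_inv] at h1
  exact h1.symm

end Limit

/-! ### Error of a normalized weighted average -/

section WeightedAverage

open MeasureTheory

variable {V : Type} [NormedAddCommGroup V] [NormedSpace ℝ V]
  {M : Type*} [TopologicalSpace M] [ChartedSpace V M]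

/-- The difference between a function on the group and its weighted average, when the function
varies little on the support of the weight. -/
theorem IsOrbitCutoff.norm_weighted_average_sub_le {G : Type*} [TopologicalSpace G] [T2Space G]
    [Group G] [IsTopologicalGroup G] [MulAction G M] {C : SubMulAction G M} [ContinuousSMul G C]
    [MeasurableSpace G] [BorelSpace G] (μ : Measure G) [IsFiniteMeasureOnCompacts μ]
    {E : Type*} [NormedAddCommGroup E] [NormedSpace ℝ E] {b : C → ℝ} (hb : IsOrbitCutoff V b)
    {c : C} (hχ : 0 < ∫ k, b (k⁻¹ • c) ∂μ) {A : G → E →L[ℝ] ℂ} (hA : Continuous A) {g : G} {ε : ℝ}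
    (hε : ∀ k, b (k⁻¹ • c) ≠ 0 → ‖A (k⁻¹ * g) - A g‖ ≤ ε) (v : E) :
    ‖((∫ k, b (k⁻¹ • c) ∂μ : ℝ) : ℂ)⁻¹ * (∫ k, (b (k⁻¹ • c) : ℂ) * A (k⁻¹ * g) v ∂μ) - A g v‖ ≤
      ε * ‖v‖ := by
  have hi := hb.integrable μ c (ψ := fun k ↦ A (k⁻¹ * g) v)
    ((hA.comp (continuous_inv.mul continuous_const)).clm_apply continuous_const)
  have hi' := hb.integrable μ c (ψ := fun _ ↦ A g v) continuous_const
  set χ := ∫ k, b (k⁻¹ • c) ∂μ with hχ_def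
  -- The normalized weight has total mass one, so `A g v` can be moved under the integral.
  have hsub : (χ : ℂ)⁻¹ * (∫ k, (b (k⁻¹ • c) : ℂ) * A (k⁻¹ * g) v ∂μ) - A g v =
      (χ : ℂ)⁻¹ * ∫ k, (b (k⁻¹ • c) : ℂ) * ((A (k⁻¹ * g) - A g) v) ∂μ := by
    have hχ0 : (χ : ℂ) ≠ 0 := by exact_mod_cast hχ.ne'
    simp only [sub_apply, mul_sub]
    rw [integral_sub hi hi', integral_mul_const, integral_complex_ofReal, ← hχ_def, mul_sub,
      inv_mul_cancel_left₀ hχ0]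
  have hbound : ‖∫ k, (b (k⁻¹ • c) : ℂ) * ((A (k⁻¹ * g) - A g) v) ∂μ‖ ≤ χ * (ε * ‖v‖) := by
    rw [hχ_def, ← integral_mul_const]
    refine norm_integral_le_of_norm_le ((hb.integrable_weight μ c).mul_const _)
      (Filter.Eventually.of_forall fun k ↦ ?_)
    rw [norm_mul, Complex.norm_real, Real.norm_of_nonneg (hb.nonneg _)]
    by_cases hk : b (k⁻¹ • c) = 0
    · simp [hk]
    · exact mul_le_mul_of_nonneg_left (ContinuousLinearMap.le_of_opNorm_le _ (hε k hk) v)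
        (hb.nonneg _)
  rw [hsub, norm_mul, norm_inv, Complex.norm_real, Real.norm_of_nonneg hχ.le]
  exact (mul_le_mul_of_nonneg_left hbound (inv_nonneg.2 hχ.le)).trans_eq
    (inv_mul_cancel_left₀ hχ.ne' _)

end WeightedAverage

/-! ### Vanishing for the surface implies vanishing for the group -/

section Forward

open Set MeasureTheory Pointwise

variable {V : Type} [NormedAddCommGroup V] [NormedSpace ℝ V] [FiniteDimensional ℝ V]
  {G : Type*} [TopologicalSpace G] [Group G]
  {M : Type*} [TopologicalSpace M] [ChartedSpace V M] [IsManifold 𝓘(ℝ, V) ∞ M]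
  [MulAction G M]

/-- At a point with trivial stabilizer the cutoff function can be chosen so that the resulting
weight on the group is supported near the identity. -/
theorem exists_isOrbitCutoff_weight [T2Space M] [IsTopologicalGroup G] {C : SubMulAction G M}
    (hC : IsClosed (C : Set M)) (hproper : ProperSMul G C) (c₀ : C)
    (hfree : ∀ g : G, g • c₀ = c₀ → g = 1) {N : Set G} (hN : N ∈ 𝓝 1) :
    ∃ b : C → ℝ, IsOrbitCutoff V b ∧ 0 < b c₀ ∧ ∀ k : G, b (k⁻¹ • c₀) ≠ 0 → k ∈ N := by
  -- The points k⁻¹c₀ with k outside the interior of `N` form a closed set by properness, and it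
  -- misses c₀ because the stabilizer is trivial. A cutoff supported in its complement has the
  -- required weight.
  have hs : IsClosed ((interior N)ᶜ⁻¹ • ({c₀} : Set C)) :=
    isOpen_interior.isClosed_compl.inv.smul_right_of_isCompact isCompact_singleton
  have hc₀ : c₀ ∉ (interior N)ᶜ⁻¹ • ({c₀} : Set C) := by
    rintro ⟨g, hg, c, rfl, h⟩
    rw [hfree g h] at hg
    exact hg (by simpa using mem_interior_iff_mem_nhds.2 hN)
  obtain ⟨b, hb, hb₀, hbN⟩ := exists_isOrbitCutoff_of_mem_nhds (V := V) hC hproper c₀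
    (hs.isOpen_compl.mem_nhds hc₀)
  refine ⟨b, hb, hb₀, fun k hk ↦ ?_⟩
  by_contra h
  exact hbN _ hk ⟨k⁻¹, by simpa using fun h' ↦ h (interior_subset h'), c₀, rfl, rfl⟩

variable {W : Type} [NormedAddCommGroup W] [NormedSpace ℝ W] [FiniteDimensional ℝ W]
  [CompleteSpace W] [T2Space G] [ChartedSpace W G] [LieGroup 𝓘(ℝ, W) ∞ G]
  [ContMDiffSMul 𝓘(ℝ, W) 𝓘(ℝ, V) ∞ G M]

/-- The cocycle is c ↦ ∫ b(k⁻¹c) a(ξ)(k⁻¹) dk. On the orbit of c it becomes a weighted average of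
left translates of the closed form a, and averaging commutes with left-invariant derivatives, so
closedness survives. -/
theorem HamiltonianGSpace.exists_averaged_cocycle [MeasurableSpace G] [BorelSpace G]
    (μ : Measure G) [IsFiniteMeasureOnCompacts μ] [μ.IsMulLeftInvariant]
    (S : HamiltonianGSpace V W G M)
    (hS : S.HasRegularConstraintSurface) (hproper : ProperSMul G S.constraintSurface)
    {b : S.constraintSurface → ℝ} (hb : IsOrbitCutoff V b)
    {a : GroupLieAlgebra 𝓘(ℝ, W) G →ₗ[ℝ] (G → ℂ)} (ha : IsLeftInvCocycle a) :
    ∃ β ∈ LinearMap.ker (LieModule.Cohomology.d₁₂ ℝ (GroupLieAlgebra 𝓘(ℝ, W) G)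
      (smoothFunctions V S.constraintSurface)), ∀ ξ c (g : G),
        (β ξ).1 (g⁻¹ • c) = ∫ k, (b (k⁻¹ • c) : ℂ) * a ξ (k⁻¹ * g) ∂μ := by
  have : CompleteSpace V := FiniteDimensional.complete ℝ V
  have : IsTopologicalGroup G := topologicalGroup_of_lieGroup 𝓘(ℝ, W) ∞
  have hint {φ : G → ℂ} (hφ : ContMDiff 𝓘(ℝ, W) 𝓘(ℝ, ℂ) ∞ φ) (c : S.constraintSurface) :
      Integrable (fun k ↦ (b (k⁻¹ • c) : ℂ) * φ k⁻¹) μ :=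
    hb.integrable μ c (hφ.continuous.comp continuous_inv)
  let β : GroupLieAlgebra 𝓘(ℝ, W) G →ₗ[ℝ] smoothFunctions V S.constraintSurface :=
    { toFun := fun ξ ↦ ⟨orbitAverage μ b fun _ k ↦ a ξ k⁻¹,
        S.orbitAverage_mem μ hS hb fun _ _ _ _ ↦
          (ha.contMDiff ξ).comp_contMDiffOn contMDiffOn_snd.inv⟩
      map_add' := fun ξ η ↦ by
        ext c
        refine Eq.trans ?_ (integral_add (hint (ha.contMDiff ξ) c) (hint (ha.contMDiff η) c))
        simp only [orbitAverage, map_add, Pi.add_apply, mul_add]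
      map_smul' := fun t ξ ↦ by
        ext c
        refine Eq.trans ?_ (integral_smul t _)
        simp only [orbitAverage, map_smul, Pi.smul_apply, mul_smul_comm] }
  -- The substitution k ↦ gk transfers the translation from the weight to the form, which is then
  -- differentiated with the weight held fixed.
  have hβ (ξ : GroupLieAlgebra 𝓘(ℝ, W) G) (c : S.constraintSurface) (g : G) :
      (β ξ).1 (g⁻¹ • c) = ∫ k, (b (k⁻¹ • c) : ℂ) * a ξ (k⁻¹ * g) ∂μ := by
    rw [← integral_mul_left_eq_self _ g]
    simp only [β, orbitAverage, LinearMap.coe_mk, AddHom.coe_mk, mul_inv_rev, mul_smul,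
      inv_mul_cancel_right]
  have hder (ξ η : GroupLieAlgebra 𝓘(ℝ, W) G) (c : S.constraintSurface) :
      (⁅ξ, β η⁆ : smoothFunctions V S.constraintSurface).1 c =
        ∫ k, (b (k⁻¹ • c) : ℂ) * leftInvDeriv ξ (a η) k⁻¹ ∂μ := by
    obtain ⟨K, hK, hbK⟩ := hb.exists_isCompact c
    have h := (contMDiff_and_leftInvDeriv_convolution μ hK (hb.contMDiff_weight c)
      (fun k hk ↦ by simp [hbK k hk]) (ha.contMDiff η)).2 ξ 1
    have h2 := leftInvDeriv_orbit (β η) c ξ 1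
    rw [funext (hβ η c), h, inv_one, one_smul] at h2
    simpa only [mul_one] using h2.symm
  refine ⟨β, ?_, hβ⟩
  rw [LinearMap.mem_ker]
  ext ξ η c
  have h0 := congrArg (fun f : smoothFunctions V S.constraintSurface ↦ f.1 c)
    (LieModule.Cohomology.d₁₂_apply_apply ℝ (GroupLieAlgebra 𝓘(ℝ, W) G) _ β ξ η)
  have h1 := integral_sub (hint (contMDiff_leftInvDeriv (ha.contMDiff η) ξ) c)
    (hint (contMDiff_leftInvDeriv (ha.contMDiff ξ) η) c)
  simp only [← mul_sub, ha.closed] at h1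
  refine h0.trans (sub_eq_zero.2 (Eq.trans ?_ h1.symm))
  exact congrArg₂ (· - ·) (hder ξ η c) (hder η ξ c)

theorem HamiltonianGSpace.exists_primitive [T2Space M] [ConnectedSpace G] (S : HamiltonianGSpace V W G M)
    (hS : S.HasRegularConstraintSurface)
    (hfree : ∀ (g : G) (c : S.constraintSurface), g • c = c → g = 1)
    (hproper : ProperSMul G S.constraintSurface)
    (hC : ∀ β ∈ LinearMap.ker (LieModule.Cohomology.d₁₂ ℝ (GroupLieAlgebra 𝓘(ℝ, W) G)
      (smoothFunctions V S.constraintSurface)), ∃ f, ceDifferentialZero ℝ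
        (GroupLieAlgebra 𝓘(ℝ, W) G) (smoothFunctions V S.constraintSurface) f = β)
    {a : GroupLieAlgebra 𝓘(ℝ, W) G →ₗ[ℝ] (G → ℂ)} (ha : IsLeftInvCocycle a) :
    ∃ φ : G → ℂ, ContMDiff 𝓘(ℝ, W) 𝓘(ℝ, ℂ) ∞ φ ∧ ∀ ξ g, leftInvDeriv ξ φ g = a ξ g := by
  have : IsTopologicalGroup G := topologicalGroup_of_lieGroup 𝓘(ℝ, W) ∞
  have : LocallyCompactSpace G := Manifold.locallyCompact_of_finiteDimensional 𝓘(ℝ, W)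
  let _ : MeasurableSpace G := borel G
  have : BorelSpace G := ⟨rfl⟩
  let μ : Measure G := Measure.haar
  obtain ⟨⟨x₀, hx₀⟩, -⟩ := id hS
  let c₀ : S.constraintSurface := ⟨x₀, hx₀⟩
  refine exists_primitive_of_approx ha.contMDiff fun Q hQ ε hε ↦ ?_
  obtain ⟨A, hA, hAa⟩ : ∃ A : G → W →L[ℝ] ℂ, Continuous A ∧ ∀ g ξ, A g ξ = a ξ g :=
    ⟨fun g ↦ LinearMap.toContinuousLinearMap (𝕜 := ℝ) (E := W) ((LinearMap.proj g).comp a),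
      continuous_clm_apply.2 fun ξ ↦ (ha.contMDiff ξ).continuous, fun _ _ ↦ rfl⟩
  have hU : IsOpen {p : G × G | ‖A (p.1⁻¹ * p.2) - A p.2‖ < ε} :=
    isOpen_lt (by fun_prop) continuous_const
  -- At k = 1 the difference `A (k⁻¹ * g) - A g` vanishes, so the tube lemma gives a neighbourhood
  -- `u` of 1 on which it is below ε for all g in `Q`. The weight is then supported in `u`.
  obtain ⟨u, v, hu, -, h1u, hQv, huv⟩ := generalized_tube_lemma (isCompact_singleton (x := (1 : G)))
    hQ hU (by rintro ⟨k, g⟩ ⟨rfl, -⟩; simpa using hε)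
  obtain ⟨b, hb, hb₀, hbu⟩ := exists_isOrbitCutoff_weight (V := V) S.isClosed_constraintSurface
    hproper c₀ (fun g ↦ hfree g c₀) (hu.mem_nhds (h1u rfl))
  obtain ⟨β, hβ, hβ'⟩ := S.exists_averaged_cocycle μ hS hproper hb ha
  obtain ⟨f, rfl⟩ := hC β hβ
  have hχ := hb.integral_weight_pos μ (c := c₀) (k := 1) (by simpa using hb₀.ne')
  set χ := ∫ k, b (k⁻¹ • c₀) ∂μ
  have hf := smoothFunctions.contMDiff_orbit_inv (W := W) (G := G) f c₀
  -- Dividing by the total weight at c₀ makes the differential of this function a genuine average of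
  -- left translates of a by elements near 1.
  refine ⟨fun g ↦ (χ : ℂ)⁻¹ * f.1 (g⁻¹ • c₀), contMDiffOn_univ.1
    (contMDiffOn_const.complex_mul hf.contMDiffOn), fun g hg ξ ↦ ?_⟩
  have hd : leftInvDeriv (ξ : GroupLieAlgebra 𝓘(ℝ, W) G) (fun g ↦ (χ : ℂ)⁻¹ * f.1 (g⁻¹ • c₀)) g =
      (χ : ℂ)⁻¹ * ∫ k, (b (k⁻¹ • c₀) : ℂ) * a ξ (k⁻¹ * g) ∂μ :=
    (leftInvDeriv_const_mul hf _ _ _).trans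
      (congrArg (_ * ·) ((leftInvDeriv_orbit f c₀ _ g).trans (hβ' ξ c₀ g)))
  have hA' (k : G) (hk : b (k⁻¹ • c₀) ≠ 0) : ‖A (k⁻¹ * g) - A g‖ ≤ ε := by
    have h1 := huv (mk_mem_prod (hbu k hk) (hQv hg))
    exact h1.le
  have hest := hb.norm_weighted_average_sub_le μ hχ hA hA' ξ
  simp only [hAa] at hest
  exact (congrArg (fun z ↦ ‖z - a ξ g‖) hd).trans_le hest

end Forward

/-! ### The equivalence of the two vanishing conditions -/

theorem subsingleton_chevalleyEilenbergH1_iff (R L Q : Type*) [CommRing R] [LieRing L]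
    [LieAlgebra R L] [AddCommGroup Q] [Module R Q] [LieRingModule L Q] [LieModule R L Q] :
    Subsingleton (ChevalleyEilenbergH1 R L Q) ↔
      ∀ β ∈ LinearMap.ker (LieModule.Cohomology.d₁₂ R L Q), ∃ q, ceDifferentialZero R L Q q = β := by
  rw [Submodule.Quotient.subsingleton_iff, Submodule.submoduleOf_eq_top]
  rfl

theorem mainTheorem10 {m n : ℕ}
    (G : Type*) [TopologicalSpace G] [T2Space G] [ConnectedSpace G]
    [ChartedSpace (EuclideanSpace ℝ (Fin n)) G] [Group G] [LieGroup (𝓡 n) ∞ G]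
    (M : Type*) [TopologicalSpace M] [T2Space M] [SecondCountableTopology M]
    [ChartedSpace (EuclideanSpace ℝ (Fin m)) M] [IsManifold (𝓡 m) ∞ M]
    [MulAction G M] [ContMDiffSMul (𝓡 n) (𝓡 m) ∞ G M]
    (S : HamiltonianGSpace (EuclideanSpace ℝ (Fin m)) (EuclideanSpace ℝ (Fin n)) G M)
    (hregular : S.HasRegularConstraintSurface)
    (hfree : ∀ (g : G) (c : S.constraintSurface), g • c = c → g = 1)
    (hproper : ProperSMul G S.constraintSurface) :
    Subsingleton (ChevalleyEilenbergH1 ℝ (GroupLieAlgebra (𝓡 n) G)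
        (smoothFunctions (EuclideanSpace ℝ (Fin m)) S.constraintSurface)) ↔
      Subsingleton (DeRhamH1 (EuclideanSpace ℝ (Fin n)) G) := by
  rw [subsingleton_deRhamH1_iff, subsingleton_chevalleyEilenbergH1_iff]
  constructor
  · exact fun h a ha ↦ S.exists_primitive hregular hfree hproper h ha
  · exact fun h β hβ ↦ S.exists_ceDifferentialZero_eq hregular hproper h hβ
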